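/- Points are measured in the $\ell_1$ distance. For a finite non-empty set $C\subseteq[0,1)^2$ and a finite multiset $X$ of points of $[0,1)^2$ (one point per user), let $$\mathrm{cost}_C(X)=\sum_{x\in X}\min_{c\in C}\|c-x\|_1 .$$ For $\ell\in\mathbb{N}\cup\{0\}$ and $\Delta=2^\ell$ let $G_\Delta=\{(i/\Delta,j/\Delta): 0\le i,j<\Delta\}$, and for a vector $\mathbf{x}\in\mathbb{R}_{\ge 0}^{G_\Delta}$ let $\mathrm{cost}_C(\mathbf{x})=\sum_{u\in G_\Delta}\mathbf{x}(u)\min_{c\in C}\|c-u\|_1$. The vector $\mathbf{x}$ is a $(\lambda,\kappa)$-coreset for $X$ (with respect to $k$-median) if for every $C\subseteq[0,1)^2$ with $|C|=k$ $$(1-\lambda)\,\mathrm{cost}_C(X)-\kappa\;\le\;\mathrm{cost}_C(\mathbf{x})\;\le\;(1+\lambda)\,\mathrm{cost}_C(X)+\kappa .$$ A randomized algorithm $\mathcal{M}$ on such datasets is $\varepsilon$-DP if $\Pr[\mathcal{M}(X)\in O]\le e^{\varepsilon}\Pr[\mathcal{M}(X')\in O]$ for every measurable set $O$ of outputs and all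 datasets $X,X'$ one of which results from the other by adding a single user's point. **Corollary.** For every $\lambda\in(0,1)$ there is a constant $A_\lambda>0$, depending only on $\lambda$, such that for every $\varepsilon>0$ and every integer $k\ge 1$ there is an $\varepsilon$-DP randomized algorithm $\mathcal{M}$ (with parameters $\lambda,\varepsilon,k$) which, on every dataset $X$ of any finite number of points of $[0,1)^2$, outputs some $\ell\in\mathbb{N}\cup\{0\}$ and a vector $\mathbf{x}\in\mathbb{R}_{\ge 0}^{G_{2^\ell}}$ such that, with probability at least $0.99$, $\mathbf{x}$ is a $(\lambda, A_\lambda\sqrt{k}/\varepsilon)$-coreset for $X$ with respect to $k$-median. -/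

import Mathlib

open MeasureTheory
open scoped NNReal ENNReal

namespace PrivateKMedian

/-- The half-open unit square `[0, 1)²`. -/
abbrev UnitSquare : Type :=
  {p : ℝ × ℝ // p.1 ∈ Set.Ico (0 : ℝ) 1 ∧ p.2 ∈ Set.Ico (0 : ℝ) 1}

/-- The `ℓ₁` distance in the plane. -/
def l1Dist (p q : ℝ × ℝ) : ℝ := |p.1 - q.1| + |p.2 - q.2|

/-- `min_{c ∈ C} ‖c - u‖₁` for a finite non-empty set `C` of centers. -/
noncomputable def distToCenters (C : Finset UnitSquare) (hC : C.Nonempty) (u : ℝ × ℝ) : ℝ :=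
  C.inf' hC fun c => l1Dist c.1 u

/-- A dataset: one point of `[0, 1)²` per user, for an arbitrary finite number of users. -/
abbrev Dataset : Type := Multiset UnitSquare

/-- The `k`-median objective `cost_C(X) = ∑_{x ∈ X} min_{c ∈ C} ‖c - x‖₁` of a dataset. -/
noncomputable def datasetCost (C : Finset UnitSquare) (hC : C.Nonempty) (X : Dataset) : ℝ :=
  (X.map fun x => distToCenters C hC x.1).sum

/-- Index set of the grid `G_Δ = {(i/Δ, j/Δ) | 0 ≤ i, j < Δ}` with `Δ = 2 ^ ℓ`. -/
abbrev GridIndex (ℓ : ℕ) : Type := Fin (2 ^ ℓ) × Fin (2 ^ ℓ)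

/-- The point `(i/Δ, j/Δ)` of `[0, 1)²`, where `Δ = 2 ^ ℓ`. -/
noncomputable def gridPoint (ℓ : ℕ) (u : GridIndex ℓ) : ℝ × ℝ :=
  (((u.1 : ℕ) : ℝ) / 2 ^ ℓ, ((u.2 : ℕ) : ℝ) / 2 ^ ℓ)

/-- A resolution `ℓ` together with a non-negative vector indexed by `G_Δ`, `Δ = 2 ^ ℓ`.
It carries the disjoint-union σ-algebra of the Borel σ-algebras. -/
abbrev GridVector : Type := Σ ℓ : ℕ, (GridIndex ℓ → ℝ≥0)

/-- `cost_C(x) = ∑_{u ∈ G_Δ} x(u) · min_{c ∈ C} ‖c - u‖₁` for a non-negative grid vector `x`. -/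
noncomputable def vectorCost (C : Finset UnitSquare) (hC : C.Nonempty) (x : GridVector) : ℝ :=
  ∑ u : GridIndex x.1, (x.2 u : ℝ) * distToCenters C hC (gridPoint x.1 u)

/-- `x` is a `(lam, κ)`-coreset for `X` with respect to the planar `k`-median objective. -/
def IsCoreset (k : ℕ) (lam κ : ℝ) (X : Dataset) (x : GridVector) : Prop :=
  ∀ (C : Finset UnitSquare) (hC : C.Nonempty), C.card = k →
    (1 - lam) * datasetCost C hC X - κ ≤ vectorCost C hC x ∧
      vectorCost C hC x ≤ (1 + lam) * datasetCost C hC X + κ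

/-- Datasets are neighbors if one results from the other by adding a single user's data. -/
def Neighbors {α : Type*} (X X' : Multiset α) : Prop :=
  (∃ a, X' = a ::ₘ X) ∨ (∃ a, X = a ::ₘ X')

/-- Pure differential privacy of a randomized algorithm, given by its output distributions. -/
def IsDP {α Ω : Type*} [MeasurableSpace Ω] (ε : ℝ) (M : Multiset α → ProbabilityMeasure Ω) :
    Prop :=
  ∀ X X' : Multiset α, Neighbors X X' → ∀ O : Set Ω, MeasurableSet O →
    (M X : Measure Ω) O ≤ ENNReal.ofReal (Real.exp ε) * (M X' : Measure Ω) O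

end PrivateKMedian

/-! The mechanism descends the quadtree of the unit square. At each level it adds two-sided
geometric noise to the counts of the children of the cells kept so far, and keeps the `w` children
with the largest noisy counts, `w` being of order `k / lam ^ 2`. The rest is post-processing: a
dataset `Y` fitting the noisy counts nearly optimally is chosen, and its grid counts are released.

Utility: round each point to the corner of the deepest kept cell containing it. The rounded cost is
linear in the kept counts, with coefficients `O(2^-i)` at level `i`, so datasets fitting the same
noisy counts have close rounded costs (`abs_sum_roundedDist_sub_le`). Rounding is cheap for every
dataset (`abs_datasetCost_sub_sum_roundedDist_le`): at most `w / 2` cells of a level are near the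
`k` centers, so each dropped near cell can be paired with a kept far cell of no smaller noisy count
(`sum_dropped_le`). Dropped points are thus charged to points at distance at least `r * 2^-i`, while
moving only `O(2^-i)`; this loses a fraction `O(1/r)` of the cost, plus noise. Hence `X` and `Y`
have similar costs (`isCoreset_countVector`). The noise event does not mention the centers, so no
union bound over them is needed.

Noise: level `i` has at most `min (4^i) (4w)` queried cells. Weighted by `2^-i`, this peaks at
`O(√w)` near the level `p` with `4^p ≈ w` and decays geometrically on both sides. Budgets that decay
more slowly away from `p` still sum to `ε`, and the expected weighted error is `O(√w / ε)` whatever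
the depth. The depth can therefore be taken from the noisy number of users. Markov's inequality
finishes the proof. -/

namespace PrivateKMedian

/-! ### Discrete distributions, composition of privacy, geometric noise -/

section Probability

variable {α β : Type*}

/-- The expectation of a non-negative function under a discrete distribution. -/
noncomputable def pmfMean (p : PMF α) (g : α → ℝ≥0∞) : ℝ≥0∞ := ∑' x, p x * g x

theorem pmfMean_pure (a : α) (g : α → ℝ≥0∞) : pmfMean (PMF.pure a) g = g a := by
  unfold pmfMean
  rw [tsum_eq_single a]
  · simp
  · intro b hb
    simp [PMF.pure_apply, hb]

theorem pmfMean_bind (p : PMF α) (f : α → PMF β) (g : β → ℝ≥0∞) :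
    pmfMean (p.bind f) g = pmfMean p fun a => pmfMean (f a) g := by
  unfold pmfMean
  simp_rw [PMF.bind_apply, ← ENNReal.tsum_mul_right, ← ENNReal.tsum_mul_left]
  rw [ENNReal.tsum_comm]
  simp_rw [mul_assoc]

theorem pmfMean_mono (p : PMF α) {f g : α → ℝ≥0∞} (h : ∀ x, f x ≤ g x) :
    pmfMean p f ≤ pmfMean p g :=
  ENNReal.tsum_le_tsum fun x => mul_le_mul_right (h x) _

theorem pmfMean_add (p : PMF α) (f g : α → ℝ≥0∞) :
    pmfMean p (fun x => f x + g x) = pmfMean p f + pmfMean p g := by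
  unfold pmfMean
  simp_rw [mul_add]
  exact ENNReal.tsum_add

theorem pmfMean_const (p : PMF α) (c : ℝ≥0∞) : pmfMean p (fun _ => c) = c := by
  unfold pmfMean
  rw [ENNReal.tsum_mul_right, p.tsum_coe, one_mul]

theorem pmfMean_const_mul (p : PMF α) (c : ℝ≥0∞) (g : α → ℝ≥0∞) :
    pmfMean p (fun x => c * g x) = c * pmfMean p g := by
  unfold pmfMean
  rw [← ENNReal.tsum_mul_left]
  congr 1
  ext x
  ring

/-- Markov's inequality for discrete distributions. -/
theorem le_toOuterMeasure_of_pmfMean_le (p : PMF α) (g : α → ℝ) (S : Set α) (t : ℝ) (ht : 0 < t)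
    (hS : ∀ x, g x ≤ t → x ∈ S)
    (hg : pmfMean p (fun x => ENNReal.ofReal (g x)) ≤ ENNReal.ofReal (t / 100)) :
    ENNReal.ofReal (99 / 100) ≤ p.toOuterMeasure S := by
  have h1 : pmfMean p (fun x => S.indicator 1 x + ENNReal.ofReal (g x / t)) ≥ 1 := by
    calc (1 : ℝ≥0∞) = pmfMean p (fun _ => 1) := (pmfMean_const p 1).symm
      _ ≤ _ := by
        apply pmfMean_mono
        intro x
        by_cases hx : x ∈ S
        · simp [hx]
        · have : t < g x := by
            by_contra hc
            exact hx (hS x (not_lt.1 hc))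
          have h2 : (1 : ℝ) ≤ g x / t := by
            rw [le_div_iff₀ ht]
            linarith
          simpa [hx] using h2
  rw [pmfMean_add] at h1
  have h2 : pmfMean p (S.indicator 1) = p.toOuterMeasure S := by
    rw [PMF.toOuterMeasure_apply]
    unfold pmfMean
    congr 1
    ext x
    by_cases hx : x ∈ S <;> simp [hx]
  have h3 : pmfMean p (fun x => ENNReal.ofReal (g x / t)) ≤ ENNReal.ofReal (1 / 100) := by
    have h4 : ∀ x, ENNReal.ofReal (g x / t) = ENNReal.ofReal t⁻¹ * ENNReal.ofReal (g x) := by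
      intro x
      rw [← ENNReal.ofReal_mul (by positivity)]
      congr 1
      field_simp
    simp_rw [h4]
    rw [pmfMean_const_mul]
    calc _ ≤ ENNReal.ofReal t⁻¹ * ENNReal.ofReal (t / 100) := mul_le_mul_right hg _
      _ = _ := by
        rw [← ENNReal.ofReal_mul (by positivity)]
        congr 1
        field_simp
  rw [h2] at h1
  have h5 : ENNReal.ofReal (99 / 100) + ENNReal.ofReal (1 / 100) = 1 := by
    rw [← ENNReal.ofReal_add (by norm_num) (by norm_num)]
    norm_num
  have h6 : ENNReal.ofReal (99 / 100) + ENNReal.ofReal (1 / 100)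
      ≤ p.toOuterMeasure S + ENNReal.ofReal (1 / 100) := by
    rw [h5]
    exact h1.le.trans (add_le_add_right h3 _)
  exact (ENNReal.add_le_add_iff_right ENNReal.ofReal_ne_top).1 h6

/-- Pointwise domination of one discrete distribution by another up to the factor `exp t`. -/
def ExpDominated (t : ℝ) (p q : PMF α) : Prop :=
  ∀ x, p x ≤ ENNReal.ofReal (Real.exp t) * q x

theorem ExpDominated.refl (p : PMF α) : ExpDominated 0 p p := fun x => by simp

theorem ExpDominated.mono {s t : ℝ} (hst : s ≤ t) {p q : PMF α} (h : ExpDominated s p q) :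
    ExpDominated t p q := fun x =>
  (h x).trans (mul_le_mul_left (ENNReal.ofReal_le_ofReal (Real.exp_le_exp.2 hst)) _)

/-- Adaptive composition: the second stages are compared at the same intermediate outcome, so the
factors multiply termwise. -/
theorem ExpDominated.bind {s t : ℝ} {p q : PMF α} {f g : α → PMF β} (h : ExpDominated s p q)
    (hfg : ∀ a, ExpDominated t (f a) (g a)) : ExpDominated (s + t) (p.bind f) (q.bind g) := by
  intro x
  rw [PMF.bind_apply, PMF.bind_apply, ← ENNReal.tsum_mul_left]
  refine ENNReal.tsum_le_tsum fun a => (mul_le_mul' (h a) (hfg a x)).trans (le_of_eq ?_)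
  rw [Real.exp_add, ENNReal.ofReal_mul (Real.exp_pos _).le]
  ring

theorem ExpDominated.bind_same {s : ℝ} {p q : PMF α} (f : α → PMF β) (h : ExpDominated s p q) :
    ExpDominated s (p.bind f) (q.bind f) := by
  simpa using h.bind fun a => ExpDominated.refl (f a)

theorem ExpDominated.toMeasure_le [MeasurableSpace α] {t : ℝ} {p q : PMF α}
    (h : ExpDominated t p q) (O : Set α) (hO : MeasurableSet O) :
    p.toMeasure O ≤ ENNReal.ofReal (Real.exp t) * q.toMeasure O := by
  rw [PMF.toMeasure_apply p hO, PMF.toMeasure_apply q hO, ← ENNReal.tsum_mul_left]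
  refine ENNReal.tsum_le_tsum fun a => ?_
  by_cases ha : a ∈ O
  · simpa [ha] using h a
  · simp [ha]

/-- The mass function of the two-sided geometric distribution. -/
noncomputable def laplaceMass (a : ℝ) (z : ℤ) : ℝ :=
  (1 - Real.exp (-a)) / (1 + Real.exp (-a)) * Real.exp (-a) ^ z.natAbs

theorem laplaceMass_nonneg {a : ℝ} (ha : 0 < a) (z : ℤ) : 0 ≤ laplaceMass a z := by
  have h1 : Real.exp (-a) < 1 := by
    rw [Real.exp_lt_one_iff]
    linarith
  have h2 := Real.exp_pos (-a)
  have h3 : 0 ≤ 1 - Real.exp (-a) := by linarith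
  unfold laplaceMass
  positivity

theorem hasSum_laplaceMass {a : ℝ} (ha : 0 < a) : HasSum (laplaceMass a) 1 := by
  have h1 : Real.exp (-a) < 1 := by
    rw [Real.exp_lt_one_iff]
    linarith
  have h2 := Real.exp_pos (-a)
  have key : ∀ q : ℝ, 0 < q → q < 1 →
      HasSum (fun z : ℤ => q ^ z.natAbs) ((1 - q)⁻¹ + q * (1 - q)⁻¹) := by
    intro q hq0 hq1
    apply HasSum.of_nat_of_neg_add_one
    · simpa using hasSum_geometric_of_lt_one hq0.le hq1
    · have := (hasSum_geometric_of_lt_one hq0.le hq1).mul_left q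
      have h3 : (fun n : ℕ => q ^ (-((n : ℤ) + 1)).natAbs) = fun n => q * q ^ n := by
        ext n
        rw [Int.natAbs_neg, ← pow_succ']
        congr 1
      rw [h3]
      exact this
  have hs := (key _ h2 h1).mul_left ((1 - Real.exp (-a)) / (1 + Real.exp (-a)))
  have h4 : (1 - Real.exp (-a)) / (1 + Real.exp (-a)) *
      ((1 - Real.exp (-a))⁻¹ + Real.exp (-a) * (1 - Real.exp (-a))⁻¹) = 1 := by
    have h3 : 1 - Real.exp (-a) ≠ 0 := by linarith
    field_simp
  rw [h4] at hs
  exact hs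

/-- With `q = exp (-a)` the mean absolute value is `2q / (1 - q^2)`, which is `1 / sinh a`. -/
theorem hasSum_natAbs_mul_laplaceMass {a : ℝ} (ha : 0 < a) :
    HasSum (fun z : ℤ => laplaceMass a z * (z.natAbs : ℝ)) (Real.sinh a)⁻¹ := by
  have h1 : Real.exp (-a) < 1 := by
    rw [Real.exp_lt_one_iff]
    linarith
  have h2 := Real.exp_pos (-a)
  have key : ∀ q : ℝ, 0 < q → q < 1 →
      HasSum (fun z : ℤ => q ^ z.natAbs * (z.natAbs : ℝ))
        (q / (1 - q) ^ 2 + q / (1 - q) ^ 2) := by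
    intro q hq0 hq1
    have h := hasSum_coe_mul_geometric_of_norm_lt_one (r := q)
      (by rwa [Real.norm_eq_abs, abs_of_pos hq0])
    apply HasSum.of_nat_of_neg_add_one
    · simpa [mul_comm] using h
    · have := (hasSum_nat_add_iff' 1).2 h
      simp only [Finset.range_one, Finset.sum_singleton, Nat.cast_zero, zero_mul, sub_zero] at this
      have h3 : (fun n : ℕ => q ^ (-((n : ℤ) + 1)).natAbs * ((-((n : ℤ) + 1)).natAbs : ℝ))
          = fun n => ((n + 1 : ℕ) : ℝ) * q ^ (n + 1) := by
        ext n
        rw [Int.natAbs_neg, mul_comm]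
        congr 1
      rw [h3]
      exact this
  have hs := (key _ h2 h1).mul_left ((1 - Real.exp (-a)) / (1 + Real.exp (-a)))
  have h6 : (1 - Real.exp (-a)) / (1 + Real.exp (-a)) * (Real.exp (-a) / (1 - Real.exp (-a)) ^ 2
      + Real.exp (-a) / (1 - Real.exp (-a)) ^ 2) = (Real.sinh a)⁻¹ := by
    have h3 : 1 - Real.exp (-a) ≠ 0 := by linarith
    have h4 : Real.exp a * Real.exp (-a) = 1 := by rw [← Real.exp_add]; simp
    have h5 : 0 < Real.sinh a := Real.sinh_pos_iff.2 ha
    rw [← one_div, eq_div_iff h5.ne', Real.sinh_eq]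
    field_simp
    linear_combination 2 * h4
  rw [h6] at hs
  have h7 : (fun z : ℤ => laplaceMass a z * (z.natAbs : ℝ)) = fun z =>
      (1 - Real.exp (-a)) / (1 + Real.exp (-a)) * (Real.exp (-a) ^ z.natAbs * z.natAbs) := by
    ext z
    unfold laplaceMass
    ring
  rw [h7]
  exact hs

theorem hasSum_ofReal_laplaceMass {a : ℝ} (ha : 0 < a) (c : ℤ) :
    HasSum (fun y : ℤ => ENNReal.ofReal (laplaceMass a (y - c))) 1 := by
  have h := (Equiv.subRight c).hasSum_iff.2 (hasSum_laplaceMass ha)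
  have h2 := ENNReal.ofReal_tsum_of_nonneg
    (fun y => laplaceMass_nonneg ha ((Equiv.subRight c) y)) h.summable
  have h3 : ∑' y, laplaceMass a ((Equiv.subRight c) y) = 1 := h.tsum_eq
  rw [h3, ENNReal.ofReal_one] at h2
  rw [h2]
  exact ENNReal.summable.hasSum

/-- The two-sided geometric distribution with positive rate `a`, centered at `c`. -/
noncomputable def positiveRateLaplace (a : ℝ) (ha : 0 < a) (c : ℤ) : PMF ℤ :=
  ⟨fun y => ENNReal.ofReal (laplaceMass a (y - c)), hasSum_ofReal_laplaceMass ha c⟩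

/-- The two-sided geometric distribution with rate `a`, centered at `c`; a point mass if the rate
is not positive. -/
noncomputable def discreteLaplace (a : ℝ) (c : ℤ) : PMF ℤ :=
  if ha : 0 < a then positiveRateLaplace a ha c else PMF.pure 0

theorem discreteLaplace_apply {a : ℝ} (ha : 0 < a) (c y : ℤ) :
    discreteLaplace a c y = ENNReal.ofReal (laplaceMass a (y - c)) := by
  rw [discreteLaplace, dif_pos ha]
  rfl

theorem pmfMean_discreteLaplace_le {a : ℝ} (ha : 0 < a) (c : ℤ) :
    pmfMean (discreteLaplace a c) (fun y => ENNReal.ofReal |(c : ℝ) - (y : ℝ)|)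
      ≤ ENNReal.ofReal a⁻¹ := by
  have h := (Equiv.subRight c).hasSum_iff.2 (hasSum_natAbs_mul_laplaceMass ha)
  have h2 := ENNReal.ofReal_tsum_of_nonneg (f := fun y =>
      laplaceMass a (Equiv.subRight c y) * ((Equiv.subRight c y).natAbs : ℝ))
    (fun y => mul_nonneg (laplaceMass_nonneg ha _) (Nat.cast_nonneg _)) h.summable
  have h3 : ∑' y, laplaceMass a (Equiv.subRight c y) * ((Equiv.subRight c y).natAbs : ℝ)
      = (Real.sinh a)⁻¹ := h.tsum_eq
  rw [h3] at h2
  have h4 : pmfMean (discreteLaplace a c) (fun y => ENNReal.ofReal |(c : ℝ) - (y : ℝ)|)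
      = ENNReal.ofReal (Real.sinh a)⁻¹ := by
    rw [h2]
    unfold pmfMean
    congr 1
    ext y
    rw [discreteLaplace_apply ha, ENNReal.ofReal_mul (laplaceMass_nonneg ha _)]
    congr 2
    rw [Nat.cast_natAbs]
    simp [abs_sub_comm]
  rw [h4]
  apply ENNReal.ofReal_le_ofReal
  exact inv_anti₀ ha (Real.self_le_sinh_iff.2 ha.le)

theorem discreteLaplace_expDominated {a : ℝ} (ha : 0 < a) (c c' : ℤ) :
    ExpDominated (a * |(c : ℝ) - c'|) (discreteLaplace a c) (discreteLaplace a c') := by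
  intro y
  rw [discreteLaplace_apply ha, discreteLaplace_apply ha,
    ← ENNReal.ofReal_mul (Real.exp_pos _).le]
  apply ENNReal.ofReal_le_ofReal
  unfold laplaceMass
  have h1 : Real.exp (-a) < 1 := by
    rw [Real.exp_lt_one_iff]
    linarith
  have h2 := Real.exp_pos (-a)
  have h3 : 0 ≤ (1 - Real.exp (-a)) / (1 + Real.exp (-a)) := by
    apply div_nonneg <;> linarith
  rw [mul_left_comm]
  refine mul_le_mul_of_nonneg_left ?_ h3
  rw [← Real.exp_nat_mul, ← Real.exp_nat_mul, ← Real.exp_add]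
  apply Real.exp_le_exp.2
  rw [Nat.cast_natAbs, Nat.cast_natAbs]
  push_cast
  have := abs_sub_le (y : ℝ) c c'
  nlinarith

end Probability

/-! ### Quadtree cells and their corners -/

section Quadtree

/-- The level-`i` quadtree cell of a point, given by its integer coordinates. -/
noncomputable def cell (i : ℕ) (x : ℝ × ℝ) : ℕ × ℕ := (⌊x.1 * 2 ^ i⌋₊, ⌊x.2 * 2 ^ i⌋₊)

/-- The lower left corner of a level-`i` quadtree cell. -/
noncomputable def corner (i : ℕ) (u : ℕ × ℕ) : ℝ × ℝ := ((u.1 : ℝ) / 2 ^ i, (u.2 : ℝ) / 2 ^ i)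

/-- The cell of the previous level containing a given cell. -/
def parent (u : ℕ × ℕ) : ℕ × ℕ := (u.1 / 2, u.2 / 2)

/-- The cells of the next level contained in one of the given cells. -/
def children (S : Finset (ℕ × ℕ)) : Finset (ℕ × ℕ) :=
  (S ×ˢ (Finset.range 2 ×ˢ Finset.range 2)).image fun p => (2 * p.1.1 + p.2.1, 2 * p.1.2 + p.2.2)

theorem mem_children {S : Finset (ℕ × ℕ)} {v : ℕ × ℕ} : v ∈ children S ↔ parent v ∈ S := by
  unfold children parent
  simp only [Finset.mem_image, Finset.mem_product, Finset.mem_range, Prod.exists]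
  constructor
  · rintro ⟨a, b, c, d, ⟨h1, h2, h3⟩, rfl⟩
    convert h1 using 2 <;> simp <;> omega
  · intro h
    refine ⟨v.1 / 2, v.2 / 2, v.1 % 2, v.2 % 2, ⟨h, by omega, by omega⟩, ?_⟩
    ext <;> simp <;> omega

theorem card_children_le (S : Finset (ℕ × ℕ)) : (children S).card ≤ 4 * S.card := by
  refine Finset.card_image_le.trans ?_
  simp [Finset.card_product]
  omega

theorem parent_cell (i : ℕ) (x : ℝ × ℝ) : parent (cell (i + 1) x) = cell i x := by
  unfold parent cell
  have h : ∀ a : ℝ, ⌊a * 2 ^ (i + 1)⌋₊ / 2 = ⌊a * 2 ^ i⌋₊ := by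
    intro a
    have := Nat.mul_cast_floor_div_cancel (n := 2) (by norm_num) (a * 2 ^ i)
    rw [← this]
    congr 2
    push_cast
    ring
  simp only [h]

theorem cell_zero (x : UnitSquare) : cell 0 x.1 = (0, 0) := by
  obtain ⟨x, h1, h2⟩ := x
  unfold cell
  simp only [pow_zero, mul_one]
  rw [Nat.floor_eq_zero.2 h1.2, Nat.floor_eq_zero.2 h2.2]

theorem l1Dist_corner_cell_le (i : ℕ) (x : UnitSquare) :
    l1Dist x.1 (corner i (cell i x.1)) ≤ 2 * (1 / 2) ^ i := by
  obtain ⟨x, h1, h2⟩ := x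
  have h : ∀ a : ℝ, 0 ≤ a → |a - (⌊a * 2 ^ i⌋₊ : ℝ) / 2 ^ i| ≤ (1 / 2) ^ i := by
    intro a ha
    have hp : (0 : ℝ) < 2 ^ i := by positivity
    have h3 := Nat.floor_le (a := a * 2 ^ i) (by positivity)
    have h4 := Nat.lt_floor_add_one (a * 2 ^ i)
    have h5 : a - (⌊a * 2 ^ i⌋₊ : ℝ) / 2 ^ i = (a * 2 ^ i - ⌊a * 2 ^ i⌋₊) * (1 / 2) ^ i := by
      rw [one_div, inv_pow]
      field_simp
    rw [h5, abs_mul, abs_of_nonneg (by linarith : 0 ≤ a * 2 ^ i - ⌊a * 2 ^ i⌋₊),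
      abs_of_pos (by positivity : (0 : ℝ) < (1 / 2) ^ i)]
    exact mul_le_of_le_one_left (by positivity) (by linarith)
  have := h _ h1.1
  have := h _ h2.1
  unfold l1Dist corner cell
  simp only
  linarith

theorem l1Dist_corner_parent_le (i : ℕ) (u : ℕ × ℕ) :
    l1Dist (corner (i + 1) u) (corner i (parent u)) ≤ 2 * (1 / 2) ^ (i + 1) := by
  have h : ∀ a : ℕ, |(a : ℝ) / 2 ^ (i + 1) - ((a / 2 : ℕ) : ℝ) / 2 ^ i| ≤ (1 / 2) ^ (i + 1) := by
    intro a
    have h1 : (a : ℝ) = 2 * ((a / 2 : ℕ) : ℝ) + ((a % 2 : ℕ) : ℝ) := by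
      exact_mod_cast (Nat.div_add_mod a 2).symm
    have h2 : ((a % 2 : ℕ) : ℝ) ≤ 1 := by
      exact_mod_cast Nat.lt_succ_iff.1 (Nat.mod_lt a (by norm_num))
    have h3 : (a : ℝ) / 2 ^ (i + 1) - ((a / 2 : ℕ) : ℝ) / 2 ^ i
        = ((a % 2 : ℕ) : ℝ) * (1 / 2) ^ (i + 1) := by
      conv_lhs => rw [h1]
      rw [one_div, inv_pow]
      field_simp
      ring
    rw [h3, abs_of_nonneg (by positivity)]
    exact mul_le_of_le_one_left (by positivity) h2
  have := h u.1
  have := h u.2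
  unfold l1Dist corner parent
  simp only
  linarith

end Quadtree

/-! ### Distance to the centers and cells near them -/

section Centers

variable (C : Finset UnitSquare) (hC : C.Nonempty)

theorem l1Dist_comm (p q : ℝ × ℝ) : l1Dist p q = l1Dist q p := by
  unfold l1Dist
  rw [abs_sub_comm p.1, abs_sub_comm p.2]

theorem l1Dist_triangle (p q r : ℝ × ℝ) : l1Dist p r ≤ l1Dist p q + l1Dist q r := by
  unfold l1Dist
  linarith [abs_sub_le p.1 q.1 r.1, abs_sub_le p.2 q.2 r.2]

theorem l1Dist_nonneg (p q : ℝ × ℝ) : 0 ≤ l1Dist p q := by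
  unfold l1Dist
  positivity

theorem distToCenters_nonneg (u : ℝ × ℝ) : 0 ≤ distToCenters C hC u :=
  Finset.le_inf' _ _ fun _ _ => l1Dist_nonneg _ _

theorem distToCenters_le_add (u v : ℝ × ℝ) :
    distToCenters C hC u ≤ distToCenters C hC v + l1Dist u v := by
  obtain ⟨c, hc, h⟩ := Finset.exists_mem_eq_inf' hC fun c : UnitSquare => l1Dist c.1 v
  unfold distToCenters
  rw [h]
  refine (Finset.inf'_le _ hc).trans ?_
  rw [l1Dist_comm u v]
  exact l1Dist_triangle _ _ _

theorem abs_distToCenters_sub_le (u v : ℝ × ℝ) :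
    |distToCenters C hC u - distToCenters C hC v| ≤ l1Dist u v := by
  have h1 := distToCenters_le_add C hC u v
  have h2 := distToCenters_le_add C hC v u
  rw [l1Dist_comm v u] at h2
  rw [abs_le]
  constructor <;> linarith

theorem distToCenters_zero_le : distToCenters C hC (0, 0) ≤ 2 := by
  obtain ⟨c, hc⟩ := hC
  refine (Finset.inf'_le _ hc).trans ?_
  obtain ⟨c, h1, h2⟩ := c
  unfold l1Dist
  simp only [sub_zero]
  rw [abs_of_nonneg h1.1, abs_of_nonneg h2.1]
  linarith [h1.2, h2.2]

/-- The level-`i` cells whose index is within `r` of the index of the cell of some center. -/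
noncomputable def nearCells (i r : ℕ) : Finset (ℕ × ℕ) :=
  C.biUnion fun c => Finset.Icc ((cell i c.1).1 - r) ((cell i c.1).1 + r) ×ˢ
    Finset.Icc ((cell i c.1).2 - r) ((cell i c.1).2 + r)

theorem card_nearCells_le (i r : ℕ) : (nearCells C i r).card ≤ C.card * (2 * r + 1) ^ 2 := by
  apply Finset.card_biUnion_le_card_mul
  intro c _
  rw [Finset.card_product, Nat.card_Icc, Nat.card_Icc, sq]
  apply Nat.mul_le_mul <;> omega

/-- Some cell index differs from that of each center by at least `r + 1`, and taking floors loses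
less than one cell side. -/
theorem le_distToCenters_of_notMem_nearCells (i r : ℕ) (z : UnitSquare)
    (hz : cell i z.1 ∉ nearCells C i r) : r * (1 / 2) ^ i ≤ distToCenters C hC z.1 := by
  apply Finset.le_inf'
  intro c hc
  have h : ∀ a b : ℝ, 0 ≤ a → 0 ≤ b → ¬ (⌊a * 2 ^ i⌋₊ - r ≤ ⌊b * 2 ^ i⌋₊ ∧
      ⌊b * 2 ^ i⌋₊ ≤ ⌊a * 2 ^ i⌋₊ + r) → r * (1 / 2) ^ i ≤ |a - b| := by
    intro a b ha hb hab
    have hp : (0 : ℝ) < 2 ^ i := by positivity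
    have h1 := Nat.floor_le (a := a * 2 ^ i) (by positivity)
    have h2 := Nat.lt_floor_add_one (a * 2 ^ i)
    have h3 := Nat.floor_le (a := b * 2 ^ i) (by positivity)
    have h4 := Nat.lt_floor_add_one (b * 2 ^ i)
    have h5 : (r : ℝ) ≤ |a - b| * 2 ^ i := by
      rw [← abs_of_pos hp, ← abs_mul, sub_mul]
      rcases le_or_gt (⌊b * 2 ^ i⌋₊ + r + 1) ⌊a * 2 ^ i⌋₊ with h6 | h6
      · have h7 : (⌊b * 2 ^ i⌋₊ : ℝ) + r + 1 ≤ ⌊a * 2 ^ i⌋₊ := by exact_mod_cast h6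
        exact le_trans (by linarith) (le_abs_self _)
      · have h7 : ⌊a * 2 ^ i⌋₊ + r + 1 ≤ ⌊b * 2 ^ i⌋₊ := by omega
        have h7 : (⌊a * 2 ^ i⌋₊ : ℝ) + r + 1 ≤ ⌊b * 2 ^ i⌋₊ := by exact_mod_cast h7
        exact le_trans (by linarith) (neg_le_abs _)
    rw [one_div, inv_pow, ← div_eq_mul_inv, div_le_iff₀ hp]
    exact h5
  have h1 : ¬ (cell i z.1 ∈ Finset.Icc ((cell i c.1).1 - r) ((cell i c.1).1 + r) ×ˢ
      Finset.Icc ((cell i c.1).2 - r) ((cell i c.1).2 + r)) := fun hm =>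
    hz (Finset.mem_biUnion.2 ⟨c, hc, hm⟩)
  rw [Finset.mem_product, Finset.mem_Icc, Finset.mem_Icc, not_and_or] at h1
  unfold l1Dist
  rcases h1 with h1 | h1
  · exact (h _ _ c.2.1.1 z.2.1.1 h1).trans (le_add_of_nonneg_right (abs_nonneg _))
  · exact (h _ _ c.2.2.1 z.2.2.1 h1).trans (le_add_of_nonneg_left (abs_nonneg _))

end Centers

/-! ### Cell counts and far points -/

section Counts

/-- The number of data points in a level-`i` cell. -/
noncomputable def cellCount (i : ℕ) (X : Dataset) (u : ℕ × ℕ) : ℕ :=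
  (X.map fun x => cell i x.1).count u

theorem cellCount_cons (i : ℕ) (a : UnitSquare) (X : Dataset) (u : ℕ × ℕ) :
    cellCount i (a ::ₘ X) u = cellCount i X u + if u = cell i a.1 then 1 else 0 := by
  unfold cellCount
  rw [Multiset.map_cons, Multiset.count_cons]

theorem sum_cellCount_mul (i : ℕ) (X : Dataset) (S : Finset (ℕ × ℕ)) (g : ℕ × ℕ → ℝ) :
    ∑ u ∈ S, (cellCount i X u : ℝ) * g u =
      (X.map fun x => if cell i x.1 ∈ S then g (cell i x.1) else 0).sum := by
  induction X using Multiset.induction_on with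
  | empty => simp [cellCount]
  | cons a X ih =>
    rw [Multiset.map_cons, Multiset.sum_cons, ← ih, add_comm]
    simp_rw [cellCount_cons]
    push_cast
    simp_rw [add_mul]
    rw [Finset.sum_add_distrib]
    simp

theorem cellCount_zero (X : Dataset) : cellCount 0 X (0, 0) = X.card := by
  unfold cellCount
  simp_rw [cell_zero]
  simp

/-- The number of data points at distance at least `t` from the centers. -/
noncomputable def farCount (C : Finset UnitSquare) (hC : C.Nonempty) (t : ℝ) (Z : Dataset) : ℝ :=
  (Z.map fun z => if t ≤ distToCenters C hC z.1 then (1 : ℝ) else 0).sum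

theorem sum_cellCount_le_farCount (C : Finset UnitSquare) (hC : C.Nonempty) (i r : ℕ) (Z : Dataset)
    (V : Finset (ℕ × ℕ)) (hV : Disjoint V (nearCells C i r)) :
    ∑ u ∈ V, (cellCount i Z u : ℝ) ≤ farCount C hC (r * (1 / 2) ^ i) Z := by
  have h := sum_cellCount_mul i Z V fun _ => 1
  simp only [mul_one] at h
  rw [h]
  apply Multiset.sum_map_le_sum_map
  intro z _
  by_cases hz : cell i z.1 ∈ V
  · rw [if_pos hz, if_pos (le_distToCenters_of_notMem_nearCells C hC i r z
      (Finset.disjoint_left.1 hV hz))]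
  · rw [if_neg hz]
    split_ifs <;> norm_num

end Counts

/-! ### Keeping the top cells and the exchange argument -/

section Selection

theorem exists_top_subset {α : Type*} [DecidableEq α] (y : α → ℤ) (T : Finset α) (w : ℕ)
    (hw : w ≤ T.card) :
    ∃ S ⊆ T, S.card = w ∧ ∀ u ∈ S, ∀ v ∈ T \ S, y v ≤ y u := by
  induction w with
  | zero => exact ⟨∅, by simp⟩
  | succ w ih =>
    obtain ⟨S, hST, hS, h⟩ := ih (by omega)
    have hne : (T \ S).Nonempty := by
      rw [← Finset.card_pos, Finset.card_sdiff_of_subset hST]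
      omega
    obtain ⟨u, hu, hmax⟩ := Finset.exists_max_image (T \ S) y hne
    have hu' := Finset.mem_sdiff.1 hu
    refine ⟨insert u S, Finset.insert_subset hu'.1 hST, ?_, ?_⟩
    · rw [Finset.card_insert_of_notMem hu'.2, hS]
    · intro a ha v hv
      have hv' : v ∈ T \ S := by
        simp only [Finset.mem_sdiff, Finset.mem_insert, not_or] at hv ⊢
        exact ⟨hv.1, hv.2.2⟩
      rcases Finset.mem_insert.1 ha with rfl | ha
      · exact hmax v hv'
      · exact h a ha v hv'

/-- Exactly `w` cells are kept as soon as one is dropped; the exchange argument needs this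
abundance. -/
theorem exists_topCells (w : ℕ) (y : ℕ × ℕ → ℤ) (T : Finset (ℕ × ℕ)) :
    ∃ S ⊆ T, S.card ≤ w ∧ ((T \ S).Nonempty → S.card = w) ∧
      ∀ u ∈ S, ∀ v ∈ T \ S, y v ≤ y u := by
  rcases le_or_gt w T.card with h | h
  · obtain ⟨S, h1, h2, h3⟩ := exists_top_subset y T w h
    exact ⟨S, h1, h2.le, fun _ => h2, h3⟩
  · exact ⟨T, subset_rfl, h.le, by simp, by simp⟩

/-- A choice of the (at most) `w` cells of `T` with largest score. -/
noncomputable def topCells (w : ℕ) (y : ℕ × ℕ → ℤ) (T : Finset (ℕ × ℕ)) : Finset (ℕ × ℕ) :=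
  (exists_topCells w y T).choose

theorem topCells_subset (w : ℕ) (y : ℕ × ℕ → ℤ) (T : Finset (ℕ × ℕ)) : topCells w y T ⊆ T :=
  (exists_topCells w y T).choose_spec.1

theorem card_topCells_le (w : ℕ) (y : ℕ × ℕ → ℤ) (T : Finset (ℕ × ℕ)) :
    (topCells w y T).card ≤ w :=
  (exists_topCells w y T).choose_spec.2.1

theorem card_topCells_eq {w : ℕ} {y : ℕ × ℕ → ℤ} {T : Finset (ℕ × ℕ)}
    (h : (T \ topCells w y T).Nonempty) : (topCells w y T).card = w :=
  (exists_topCells w y T).choose_spec.2.2.1 h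

theorem le_of_mem_topCells {w : ℕ} {y : ℕ × ℕ → ℤ} {T : Finset (ℕ × ℕ)} {u v : ℕ × ℕ}
    (hu : u ∈ topCells w y T) (hv : v ∈ T \ topCells w y T) : y v ≤ y u :=
  (exists_topCells w y T).choose_spec.2.2.2 u hu v hv

/-- The `ℓ₁` error of the scores `y` as estimates of the cell counts on `T`. -/
noncomputable def levelError (i : ℕ) (Z : Dataset) (T : Finset (ℕ × ℕ)) (y : ℕ × ℕ → ℤ) : ℝ :=
  ∑ u ∈ T, |(cellCount i Z u : ℝ) - y u|

theorem levelError_nonneg (i : ℕ) (Z : Dataset) (T : Finset (ℕ × ℕ)) (y : ℕ × ℕ → ℤ) :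
    0 ≤ levelError i Z T y := Finset.sum_nonneg fun _ _ => abs_nonneg _

/-- Among the points in cells that are not selected, all but an error term are matched by points
that are far from the centers. -/
theorem sum_dropped_le (C : Finset UnitSquare) (hC : C.Nonempty) (i r w : ℕ)
    (hw : 2 * (C.card * (2 * r + 1) ^ 2) ≤ w) (Z : Dataset) (T : Finset (ℕ × ℕ))
    (y : ℕ × ℕ → ℤ) :
    ∑ u ∈ T \ topCells w y T, (cellCount i Z u : ℝ) ≤
      2 * farCount C hC (r * (1 / 2) ^ i) Z + levelError i Z T y := by
  set S := topCells w y T with hS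
  set K := nearCells C i r with hK
  set F := farCount C hC (r * (1 / 2) ^ i) Z
  have hST : S ⊆ T := topCells_subset w y T
  set D := (T \ S) ∩ K with hD
  have hsplit : ∑ u ∈ T \ S, (cellCount i Z u : ℝ)
      = ∑ u ∈ D, (cellCount i Z u : ℝ) + ∑ u ∈ (T \ S) \ K, (cellCount i Z u : ℝ) :=
    (Finset.sum_inter_add_sum_sdiff _ _ _).symm
  have hfar : ∑ u ∈ (T \ S) \ K, (cellCount i Z u : ℝ) ≤ F :=
    sum_cellCount_le_farCount C hC i r Z _ Finset.sdiff_disjoint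
  have hF0 : 0 ≤ F := le_trans (Finset.sum_nonneg fun _ _ => Nat.cast_nonneg _) hfar
  have hnear : ∑ u ∈ D, (cellCount i Z u : ℝ) ≤ F + levelError i Z T y := by
    rcases D.eq_empty_or_nonempty with h0 | h0
    · rw [h0, Finset.sum_empty]
      have := levelError_nonneg i Z T y
      linarith
    · have hTS : (T \ S).Nonempty := h0.mono Finset.inter_subset_left
      have hSw : S.card = w := card_topCells_eq hTS
      have hKc : K.card ≤ C.card * (2 * r + 1) ^ 2 := card_nearCells_le C i r
      have hDc : D.card ≤ K.card := Finset.card_le_card Finset.inter_subset_right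
      have hSK : S.card - K.card ≤ (S \ K).card := Finset.le_card_sdiff K S
      -- Since `w ≥ 2 |K|`, at least `|K| ≥ |D|` kept cells are far; `N` consists of partners for
      -- `D`.
      obtain ⟨N, hN, hNc⟩ := Finset.exists_subset_card_eq (show D.card ≤ (S \ K).card by omega)
      have hN0 : N.Nonempty := by
        rw [← Finset.card_pos, hNc, Finset.card_pos]
        exact h0
      obtain ⟨u₀, hu₀, hmin⟩ := Finset.exists_min_image N y hN0
      -- The lowest partner score `y u₀` separates the dropped cells from their partners.
      have h1 : ∑ v ∈ D, (y v : ℝ) ≤ ∑ u ∈ N, (y u : ℝ) := by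
        calc ∑ v ∈ D, (y v : ℝ) ≤ D.card • (y u₀ : ℝ) := by
              apply Finset.sum_le_card_nsmul
              intro v hv
              exact_mod_cast le_of_mem_topCells (Finset.sdiff_subset (hN hu₀))
                (Finset.inter_subset_left hv)
          _ = N.card • (y u₀ : ℝ) := by rw [hNc]
          _ ≤ _ := by
              apply Finset.card_nsmul_le_sum
              intro v hv
              exact_mod_cast hmin v hv
      -- Disjointness lets the errors on `D` and `N` share a single `levelError`.
      have hdisj : Disjoint D N := by
        rw [Finset.disjoint_left]
        intro a ha hb
        exact (Finset.mem_sdiff.1 (Finset.inter_subset_left ha)).2 (Finset.sdiff_subset (hN hb))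
      have h2 : ∑ u ∈ D, |(cellCount i Z u : ℝ) - y u| + ∑ u ∈ N, |(cellCount i Z u : ℝ) - y u|
          ≤ levelError i Z T y := by
        rw [← Finset.sum_union hdisj]
        apply Finset.sum_le_sum_of_subset_of_nonneg
        · apply Finset.union_subset
          · exact Finset.inter_subset_left.trans Finset.sdiff_subset
          · exact hN.trans (Finset.sdiff_subset.trans hST)
        · intros
          exact abs_nonneg _
      have h3 : ∑ u ∈ D, (cellCount i Z u : ℝ) ≤
          ∑ u ∈ D, (y u : ℝ) + ∑ u ∈ D, |(cellCount i Z u : ℝ) - y u| := by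
        rw [← Finset.sum_add_distrib]
        apply Finset.sum_le_sum
        intro u _
        linarith [le_abs_self ((cellCount i Z u : ℝ) - y u)]
      have h4 : ∑ u ∈ N, (y u : ℝ) ≤
          ∑ u ∈ N, (cellCount i Z u : ℝ) + ∑ u ∈ N, |(cellCount i Z u : ℝ) - y u| := by
        rw [← Finset.sum_add_distrib]
        apply Finset.sum_le_sum
        intro u _
        linarith [neg_le_abs ((cellCount i Z u : ℝ) - y u)]
      have h5 : ∑ u ∈ N, (cellCount i Z u : ℝ) ≤ F :=
        sum_cellCount_le_farCount C hC i r Z N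
          (Finset.disjoint_of_subset_left hN Finset.sdiff_disjoint)
      linarith
  rw [hsplit]
  linarith

end Selection

/-! ### Rounding points to kept cells -/

section Rounding

variable (C : Finset UnitSquare) (hC : C.Nonempty)

theorem sum_pow_le_two (m : ℕ) : ∑ i ∈ Finset.range m, (1 / 2 : ℝ) ^ i ≤ 2 := by
  have h : ∑ i ∈ Finset.range m, (1 / 2 : ℝ) ^ i = 2 - 2 * (1 / 2) ^ m := by
    induction m with
    | zero => simp
    | succ m ih =>
      rw [Finset.sum_range_succ, ih, pow_succ]
      ring
  rw [h]
  have : (0 : ℝ) < (1 / 2) ^ m := by positivity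
  linarith

/-- A geometric sum is at most twice its largest term. For `s < 1` the leading term vanishes, and
rescaling by two replaces `s` by `2 * s`. -/
theorem sum_pow_le_of_le (m : ℕ) (s : ℝ) (hs : 0 ≤ s) :
    ∑ i ∈ Finset.range m, (if (1 / 2 : ℝ) ^ i ≤ s then (1 / 2 : ℝ) ^ i else 0) ≤ 2 * s := by
  induction m generalizing s with
  | zero => simpa using hs
  | succ m ih =>
    rcases le_or_gt 1 s with h1 | h1
    · calc _ ≤ ∑ i ∈ Finset.range (m + 1), (1 / 2 : ℝ) ^ i := by
            apply Finset.sum_le_sum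
            intro i _
            split_ifs
            · exact le_rfl
            · positivity
        _ ≤ 2 := sum_pow_le_two _
        _ ≤ 2 * s := by linarith
    · rw [Finset.sum_range_succ', pow_zero, if_neg (not_le.2 h1), add_zero]
      have h := ih (2 * s) (by linarith)
      calc _ = (1 / 2) * ∑ i ∈ Finset.range m,
              (if (1 / 2 : ℝ) ^ i ≤ 2 * s then (1 / 2 : ℝ) ^ i else 0) := by
            rw [Finset.mul_sum]
            apply Finset.sum_congr rfl
            intro i _
            have : (1 / 2 : ℝ) ^ (i + 1) ≤ s ↔ (1 / 2 : ℝ) ^ i ≤ 2 * s := by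
              rw [pow_succ]
              constructor <;> intro <;> linarith
            by_cases hi : (1 / 2 : ℝ) ^ i ≤ 2 * s
            · rw [if_pos hi, if_pos (this.2 hi), pow_succ]
              ring
            · rw [if_neg hi, if_neg (mt this.1 hi), mul_zero]
        _ ≤ 2 * s := by linarith

/-- The distance to the centers after rounding a point to the corner of the last selected cell
containing it, written as a telescoping sum over the levels. -/
noncomputable def roundedDist (S : ℕ → Finset (ℕ × ℕ)) (ℓ : ℕ) (z : ℝ × ℝ) : ℝ :=
  distToCenters C hC (0, 0) + ∑ i ∈ Finset.range ℓ, if cell (i + 1) z ∈ S (i + 1) then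
    distToCenters C hC (corner (i + 1) (cell (i + 1) z)) -
      distToCenters C hC (corner i (parent (cell (i + 1) z))) else 0

theorem abs_distToCenters_corner_sub_le (i : ℕ) (u : ℕ × ℕ) :
    |distToCenters C hC (corner (i + 1) u) - distToCenters C hC (corner i (parent u))|
      ≤ 2 * (1 / 2) ^ (i + 1) :=
  (abs_distToCenters_sub_le C hC _ _).trans (l1Dist_corner_parent_le i u)

/-- A point once dropped stays dropped, because kept cells have kept parents. If this happens at
level `j ≤ m`, the weights `2^-j, …, 2^-m` and the extra tail `2^-m` add up to exactly `2 * 2^-j`.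
-/
theorem sum_unselected_eq (S : ℕ → Finset (ℕ × ℕ)) (hS0 : S 0 = {(0, 0)})
    (hS : ∀ i, S (i + 1) ⊆ children (S i)) (m : ℕ) (z : UnitSquare) :
    ∑ i ∈ Finset.range m, (if cell (i + 1) z.1 ∈ S (i + 1) then (0 : ℝ) else (1 / 2) ^ (i + 1)) +
      (if cell m z.1 ∈ S m then (0 : ℝ) else (1 / 2) ^ m) =
    2 * ∑ i ∈ Finset.range m, if cell (i + 1) z.1 ∈ children (S i) \ S (i + 1) then
      (1 / 2 : ℝ) ^ (i + 1) else 0 := by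
  induction m with
  | zero => simp [cell_zero, hS0]
  | succ m ih =>
    rw [Finset.sum_range_succ, Finset.sum_range_succ, mul_add, ← ih]
    simp only [Finset.mem_sdiff, mem_children, parent_cell]
    by_cases h1 : cell (m + 1) z.1 ∈ S (m + 1)
    · have h2 : cell m z.1 ∈ S m := by
        rw [← parent_cell, ← mem_children]
        exact hS m h1
      simp [h1, h2]
    · by_cases h2 : cell m z.1 ∈ S m
      · simp only [h1, h2, if_true, if_false, not_false_eq_true, and_self]
        ring
      · simp only [h1, h2, if_false, false_and]
        rw [pow_succ]
        ring

/-- Compare with the full telescoping sum down to the level-`ℓ` corner. Each missing step is at most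
twice its weight, and the weights sum to at most twice the weight at the drop; hence the factor 4.
-/
theorem abs_distToCenters_sub_roundedDist_le (S : ℕ → Finset (ℕ × ℕ)) (hS0 : S 0 = {(0, 0)})
    (hS : ∀ i, S (i + 1) ⊆ children (S i)) (ℓ : ℕ) (z : UnitSquare) :
    |distToCenters C hC z.1 - roundedDist C hC S ℓ z.1| ≤ 2 * (1 / 2) ^ ℓ +
      4 * ∑ i ∈ Finset.range ℓ, if cell (i + 1) z.1 ∈ children (S i) \ S (i + 1) then
        (1 / 2 : ℝ) ^ (i + 1) else 0 := by
  set g : ℕ → ℝ := fun i => distToCenters C hC (corner i (cell i z.1)) with hg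
  have htel : g ℓ = distToCenters C hC (0, 0) + ∑ i ∈ Finset.range ℓ, (g (i + 1) - g i) := by
    rw [Finset.sum_range_sub, hg]
    simp [cell_zero, corner]
  have hF : distToCenters C hC z.1 - roundedDist C hC S ℓ z.1 =
      (distToCenters C hC z.1 - g ℓ) + ∑ i ∈ Finset.range ℓ,
        if cell (i + 1) z.1 ∈ S (i + 1) then 0 else g (i + 1) - g i := by
    rw [htel]
    unfold roundedDist
    have : ∑ i ∈ Finset.range ℓ, (g (i + 1) - g i) =
        (∑ i ∈ Finset.range ℓ, if cell (i + 1) z.1 ∈ S (i + 1) then g (i + 1) - g i else 0) +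
        ∑ i ∈ Finset.range ℓ, if cell (i + 1) z.1 ∈ S (i + 1) then 0 else g (i + 1) - g i := by
      rw [← Finset.sum_add_distrib]
      apply Finset.sum_congr rfl
      intro i _
      split_ifs <;> simp
    rw [this]
    simp only [parent_cell, hg]
    ring
  rw [hF]
  refine (abs_add_le _ _).trans (add_le_add ?_ ?_)
  · exact (abs_distToCenters_sub_le C hC _ _).trans (l1Dist_corner_cell_le ℓ z)
  · refine (Finset.abs_sum_le_sum_abs _ _).trans ?_
    have h := sum_unselected_eq S hS0 hS ℓ z
    have h0 : (0 : ℝ) ≤ if cell ℓ z.1 ∈ S ℓ then (0 : ℝ) else (1 / 2) ^ ℓ := by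
      split_ifs <;> positivity
    calc _ ≤ ∑ i ∈ Finset.range ℓ,
          2 * (if cell (i + 1) z.1 ∈ S (i + 1) then (0 : ℝ) else (1 / 2) ^ (i + 1)) := by
          apply Finset.sum_le_sum
          intro i _
          split_ifs
          · simp
          · have := abs_distToCenters_corner_sub_le C hC i (cell (i + 1) z.1)
            rwa [parent_cell] at this
      _ ≤ _ := by
          rw [← Finset.mul_sum]
          linarith

/-- The purpose of the telescoping form: the rounded cost sees the data only through its size and
the counts of kept cells. -/
theorem sum_roundedDist_eq (S : ℕ → Finset (ℕ × ℕ)) (ℓ : ℕ) (Z : Dataset) :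
    (Z.map fun z => roundedDist C hC S ℓ z.1).sum = Z.card * distToCenters C hC (0, 0) +
      ∑ i ∈ Finset.range ℓ, ∑ u ∈ S (i + 1), (cellCount (i + 1) Z u : ℝ) *
        (distToCenters C hC (corner (i + 1) u) - distToCenters C hC (corner i (parent u))) := by
  simp_rw [sum_cellCount_mul]
  unfold roundedDist
  rw [Multiset.sum_map_add, Multiset.map_const', Multiset.sum_replicate, nsmul_eq_mul]
  congr 1
  induction Z using Multiset.induction_on with
  | empty => simp
  | cons a Z ih => simp [Finset.sum_add_distrib, ih]

/-- A point at distance `d` counts as far only at levels with `2^-(i+1) ≤ d / r`, whose weights sum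
to at most `2 * d / r`. -/
theorem mul_sum_farCount_le (r : ℕ) (hr : 0 < r) (ℓ : ℕ) (Z : Dataset) :
    ∑ i ∈ Finset.range ℓ, (1 / 2 : ℝ) ^ (i + 1) * farCount C hC (r * (1 / 2) ^ (i + 1)) Z
      ≤ 2 / r * datasetCost C hC Z := by
  have hr' : (0 : ℝ) < r := by exact_mod_cast hr
  induction Z using Multiset.induction_on with
  | empty => simp [farCount, datasetCost]
  | cons a Z ih =>
    unfold farCount datasetCost at ih ⊢
    simp only [Multiset.map_cons, Multiset.sum_cons, mul_add]
    rw [Finset.sum_add_distrib]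
    refine add_le_add ?_ ih
    have h := sum_pow_le_of_le (ℓ + 1) (distToCenters C hC a.1 / r)
      (div_nonneg (distToCenters_nonneg C hC _) hr'.le)
    rw [Finset.sum_range_succ'] at h
    have h0 : (0 : ℝ) ≤ if (1 / 2 : ℝ) ^ 0 ≤ distToCenters C hC a.1 / r then
        (1 / 2 : ℝ) ^ 0 else 0 := by split_ifs <;> norm_num
    calc _ = ∑ i ∈ Finset.range ℓ, (if (1 / 2 : ℝ) ^ (i + 1) ≤ distToCenters C hC a.1 / r then
          (1 / 2 : ℝ) ^ (i + 1) else 0) := by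
          apply Finset.sum_congr rfl
          intro i _
          rw [mul_ite, mul_one, mul_zero]
          congr 1
          rw [le_div_iff₀ hr', mul_comm]
      _ ≤ 2 * (distToCenters C hC a.1 / r) := by linarith
      _ = _ := by ring

end Rounding

/-! ### Cost estimates from a transcript of noisy counts -/

section Transcript

/-- The cells selected at each level, given the noisy counts `h`. -/
noncomputable def selected (w : ℕ) (h : ℕ → ℕ × ℕ → ℤ) : ℕ → Finset (ℕ × ℕ)
  | 0 => {(0, 0)}
  | i + 1 => topCells w (h (i + 1)) (children (selected w h i))

/-- The cells whose counts are queried at each level, given the noisy counts `h`. -/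
noncomputable def queried (w : ℕ) (h : ℕ → ℕ × ℕ → ℤ) : ℕ → Finset (ℕ × ℕ)
  | 0 => {(0, 0)}
  | i + 1 => children (selected w h i)

theorem selected_subset_queried (w : ℕ) (h : ℕ → ℕ × ℕ → ℤ) (i : ℕ) :
    selected w h i ⊆ queried w h i := by
  cases i with
  | zero => exact subset_rfl
  | succ i => exact topCells_subset _ _ _

theorem selected_congr {w : ℕ} {h h' : ℕ → ℕ × ℕ → ℤ} {i : ℕ} (hh : ∀ j ≤ i, h j = h' j) :
    selected w h i = selected w h' i := by
  induction i with
  | zero => rfl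
  | succ i ih =>
    unfold selected
    rw [ih fun j hj => hh j (by omega), hh (i + 1) le_rfl]

/-- The strict inequality matters: the cells queried at a level are fixed before that level's noise
is drawn. -/
theorem queried_congr {w : ℕ} {h h' : ℕ → ℕ × ℕ → ℤ} {i : ℕ} (hh : ∀ j < i, h j = h' j) :
    queried w h i = queried w h' i := by
  cases i with
  | zero => rfl
  | succ i =>
    simp only [queried]
    rw [selected_congr fun j hj => hh j (by omega)]

theorem card_queried_le_of_width {w : ℕ} (hw : 1 ≤ w) (h : ℕ → ℕ × ℕ → ℤ) (i : ℕ) :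
    (queried w h i).card ≤ 4 * w := by
  have hs : ∀ i, (selected w h i).card ≤ w := by
    intro i
    cases i with
    | zero => simpa [selected] using hw
    | succ i => exact card_topCells_le _ _ _
  cases i with
  | zero =>
    simp only [queried, Finset.card_singleton]
    omega
  | succ i => exact (card_children_le _).trans (Nat.mul_le_mul_left _ (hs i))

theorem card_queried_le_of_level (w : ℕ) (h : ℕ → ℕ × ℕ → ℤ) (i : ℕ) :
    (queried w h i).card ≤ 4 ^ i := by
  induction i with
  | zero => simp [queried]
  | succ i ih =>
    refine (card_children_le _).trans ?_
    rw [pow_succ']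
    exact Nat.mul_le_mul_left _ ((Finset.card_le_card (selected_subset_queried w h i)).trans ih)

/-- The weighted `ℓ₁` error of the noisy counts `h` for the dataset `Z`, over all levels up to
`ℓ`. -/
noncomputable def totalError (w : ℕ) (h : ℕ → ℕ × ℕ → ℤ) (ℓ : ℕ) (Z : Dataset) : ℝ :=
  ∑ i ∈ Finset.range (ℓ + 1), (1 / 2) ^ i * levelError i Z (queried w h i) (h i)

theorem totalError_nonneg (w : ℕ) (h : ℕ → ℕ × ℕ → ℤ) (ℓ : ℕ) (Z : Dataset) :
    0 ≤ totalError w h ℓ Z :=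
  Finset.sum_nonneg fun _ _ => mul_nonneg (by positivity) (levelError_nonneg _ _ _ _)

theorem totalError_congr {w : ℕ} {h h' : ℕ → ℕ × ℕ → ℤ} {ℓ : ℕ} (hh : ∀ j ≤ ℓ, h j = h' j)
    (Z : Dataset) : totalError w h ℓ Z = totalError w h' ℓ Z := by
  unfold totalError
  apply Finset.sum_congr rfl
  intro i hi
  have hi' := Finset.mem_range.1 hi
  rw [queried_congr fun j hj => hh j (by omega), hh i (by omega)]

theorem totalError_eq_add_sum (w : ℕ) (h : ℕ → ℕ × ℕ → ℤ) (ℓ : ℕ) (Z : Dataset) :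
    totalError w h ℓ Z = |(Z.card : ℝ) - h 0 (0, 0)| + ∑ i ∈ Finset.range ℓ,
      (1 / 2) ^ (i + 1) * levelError (i + 1) Z (queried w h (i + 1)) (h (i + 1)) := by
  unfold totalError
  rw [Finset.sum_range_succ', add_comm]
  congr 1
  simp [levelError, queried, cellCount_zero]

variable (C : Finset UnitSquare) (hC : C.Nonempty)

/-- The constant 16 is `4 * 2 * 2`: the rounding loss at a drop, the charge in `sum_dropped_le`, and
the geometric sum over far levels. -/
theorem abs_datasetCost_sub_sum_roundedDist_le (w r : ℕ) (hr : 0 < r)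
    (hw : 2 * (C.card * (2 * r + 1) ^ 2) ≤ w) (h : ℕ → ℕ × ℕ → ℤ) (ℓ : ℕ) (Z : Dataset) :
    |datasetCost C hC Z - (Z.map fun z => roundedDist C hC (selected w h) ℓ z.1).sum| ≤
      16 / r * datasetCost C hC Z + 4 * totalError w h ℓ Z + 2 * (Z.card * (1 / 2) ^ ℓ) := by
  have h1 : |datasetCost C hC Z - (Z.map fun z => roundedDist C hC (selected w h) ℓ z.1).sum| ≤
      2 * (Z.card * (1 / 2) ^ ℓ) + 4 * ∑ i ∈ Finset.range ℓ, (1 / 2 : ℝ) ^ (i + 1) *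
        ∑ u ∈ children (selected w h i) \ selected w h (i + 1), (cellCount (i + 1) Z u : ℝ) := by
    have h2 : ∀ i, ∑ u ∈ children (selected w h i) \ selected w h (i + 1),
        (cellCount (i + 1) Z u : ℝ) = (Z.map fun x => if cell (i + 1) x.1 ∈
          children (selected w h i) \ selected w h (i + 1) then (1 : ℝ) else 0).sum := by
      intro i
      rw [← sum_cellCount_mul (i + 1) Z _ fun _ => 1]
      simp
    simp_rw [h2]
    clear h2
    unfold datasetCost
    induction Z using Multiset.induction_on with
    | empty => simp
    | cons a Z ih =>
      have ha := abs_distToCenters_sub_roundedDist_le C hC (selected w h) rfl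
        (fun i => topCells_subset _ _ _) ℓ a
      simp only [Multiset.map_cons, Multiset.sum_cons, Multiset.card_cons, mul_add,
        Finset.sum_add_distrib, mul_ite, mul_one, mul_zero, Nat.cast_add, Nat.cast_one,
        add_mul, one_mul] at ih ⊢
      rw [add_sub_add_comm]
      refine (abs_add_le _ _).trans ((add_le_add ha ih).trans (le_of_eq ?_))
      ring
  refine h1.trans ?_
  have h3 : ∑ i ∈ Finset.range ℓ, (1 / 2 : ℝ) ^ (i + 1) *
      ∑ u ∈ children (selected w h i) \ selected w h (i + 1), (cellCount (i + 1) Z u : ℝ) ≤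
      2 * ∑ i ∈ Finset.range ℓ, (1 / 2 : ℝ) ^ (i + 1) *
        farCount C hC (r * (1 / 2) ^ (i + 1)) Z + totalError w h ℓ Z := by
    rw [totalError_eq_add_sum, Finset.mul_sum]
    have h4 : ∀ i ∈ Finset.range ℓ, (1 / 2 : ℝ) ^ (i + 1) *
        ∑ u ∈ children (selected w h i) \ selected w h (i + 1), (cellCount (i + 1) Z u : ℝ) ≤
        2 * ((1 / 2 : ℝ) ^ (i + 1) * farCount C hC (r * (1 / 2) ^ (i + 1)) Z) +
        (1 / 2) ^ (i + 1) * levelError (i + 1) Z (queried w h (i + 1)) (h (i + 1)) := by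
      intro i _
      refine (mul_le_mul_of_nonneg_left (sum_dropped_le C hC (i + 1) r w hw Z
        (children (selected w h i)) (h (i + 1))) (by positivity)).trans (le_of_eq ?_)
      simp only [queried]
      ring
    refine (Finset.sum_le_sum h4).trans ?_
    rw [Finset.sum_add_distrib]
    linarith [abs_nonneg ((Z.card : ℝ) - h 0 (0, 0))]
  have h5 := mul_sum_farCount_le C hC r hr ℓ Z
  have h6 : 16 / (r : ℝ) * datasetCost C hC Z = 8 * (2 / r * datasetCost C hC Z) := by ring
  rw [h6]
  linarith

/-- Both sets of counts are compared through `h`. The root has coefficient at most 2 and level `i +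
1` at most `2 * 2^-(i+1)`, twice the weights in `totalError`. -/
theorem abs_sum_roundedDist_sub_le (w : ℕ) (h : ℕ → ℕ × ℕ → ℤ) (ℓ : ℕ) (X Y : Dataset) :
    |(X.map fun z => roundedDist C hC (selected w h) ℓ z.1).sum -
      (Y.map fun z => roundedDist C hC (selected w h) ℓ z.1).sum| ≤
      2 * (totalError w h ℓ X + totalError w h ℓ Y) := by
  rw [sum_roundedDist_eq, sum_roundedDist_eq, totalError_eq_add_sum, totalError_eq_add_sum,
    add_sub_add_comm, ← sub_mul, ← Finset.sum_sub_distrib]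
  have h0 := distToCenters_zero_le C hC
  have h0' := distToCenters_nonneg C hC (0, 0)
  have h1 : |((X.card : ℝ) - Y.card) * distToCenters C hC (0, 0)| ≤
      2 * (|(X.card : ℝ) - h 0 (0, 0)| + |(Y.card : ℝ) - h 0 (0, 0)|) := by
    rw [abs_mul, abs_of_nonneg h0', mul_comm]
    have := abs_sub_le (X.card : ℝ) (h 0 (0, 0)) Y.card
    rw [abs_sub_comm ((h 0 (0, 0) : ℤ) : ℝ) (Y.card : ℝ)] at this
    exact mul_le_mul h0 this (abs_nonneg _) (by norm_num)
  have h2 : ∀ i ∈ Finset.range ℓ, |∑ u ∈ selected w h (i + 1), (cellCount (i + 1) X u : ℝ) *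
        (distToCenters C hC (corner (i + 1) u) - distToCenters C hC (corner i (parent u))) -
      ∑ u ∈ selected w h (i + 1), (cellCount (i + 1) Y u : ℝ) *
        (distToCenters C hC (corner (i + 1) u) - distToCenters C hC (corner i (parent u)))| ≤
      2 * ((1 / 2) ^ (i + 1) * levelError (i + 1) X (queried w h (i + 1)) (h (i + 1)) +
        (1 / 2) ^ (i + 1) * levelError (i + 1) Y (queried w h (i + 1)) (h (i + 1))) := by
    intro i _
    rw [← Finset.sum_sub_distrib]
    refine (Finset.abs_sum_le_sum_abs _ _).trans ?_
    calc _ ≤ ∑ u ∈ selected w h (i + 1), (2 * (1 / 2) ^ (i + 1)) *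
          (|(cellCount (i + 1) X u : ℝ) - h (i + 1) u| +
            |(cellCount (i + 1) Y u : ℝ) - h (i + 1) u|) := by
          apply Finset.sum_le_sum
          intro u _
          rw [← sub_mul, abs_mul, mul_comm]
          have := abs_sub_le (cellCount (i + 1) X u : ℝ) (h (i + 1) u) (cellCount (i + 1) Y u)
          rw [abs_sub_comm ((h (i + 1) u : ℤ) : ℝ) (cellCount (i + 1) Y u : ℝ)] at this
          exact mul_le_mul (abs_distToCenters_corner_sub_le C hC i u) this (abs_nonneg _)
            (by positivity)
      _ ≤ ∑ u ∈ queried w h (i + 1), (2 * (1 / 2) ^ (i + 1)) *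
          (|(cellCount (i + 1) X u : ℝ) - h (i + 1) u| +
            |(cellCount (i + 1) Y u : ℝ) - h (i + 1) u|) := by
          apply Finset.sum_le_sum_of_subset_of_nonneg (selected_subset_queried w h (i + 1))
          intros
          positivity
      _ = _ := by
          rw [← Finset.mul_sum, Finset.sum_add_distrib]
          unfold levelError
          ring
  have h3 := (Finset.abs_sum_le_sum_abs _ _).trans (Finset.sum_le_sum h2)
  rw [← Finset.mul_sum, Finset.sum_add_distrib] at h3
  refine (abs_add_le _ _).trans ((add_le_add h1 h3).trans (le_of_eq ?_))
  ring

end Transcript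

/-! ### From a fitting dataset to a coreset -/

section Output

/-- The grid vector of level-`ℓ` cell counts of a dataset. -/
noncomputable def countVector (ℓ : ℕ) (Y : Dataset) : GridVector :=
  ⟨ℓ, fun u => (cellCount ℓ Y (u.1, u.2) : ℝ≥0)⟩

theorem cell_mem_range (ℓ : ℕ) (x : UnitSquare) :
    cell ℓ x.1 ∈ Finset.range (2 ^ ℓ) ×ˢ Finset.range (2 ^ ℓ) := by
  obtain ⟨x, h1, h2⟩ := x
  have h : ∀ a : ℝ, 0 ≤ a → a < 1 → ⌊a * 2 ^ ℓ⌋₊ < 2 ^ ℓ := by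
    intro a h0 h1
    rw [Nat.floor_lt (by positivity)]
    push_cast
    exact mul_lt_of_lt_one_left (by positivity) h1
  simp only [cell, Finset.mem_product, Finset.mem_range]
  exact ⟨h _ h1.1 h1.2, h _ h2.1 h2.2⟩

variable (C : Finset UnitSquare) (hC : C.Nonempty)

theorem vectorCost_countVector (ℓ : ℕ) (Y : Dataset) :
    vectorCost C hC (countVector ℓ Y) =
      (Y.map fun y => distToCenters C hC (corner ℓ (cell ℓ y.1))).sum := by
  have h := sum_cellCount_mul ℓ Y (Finset.range (2 ^ ℓ) ×ˢ Finset.range (2 ^ ℓ)) fun u =>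
    distToCenters C hC (corner ℓ u)
  simp_rw [cell_mem_range, if_true] at h
  rw [← h, Finset.sum_product]
  unfold vectorCost countVector
  rw [Fintype.sum_prod_type]
  simp only [Finset.sum_range, gridPoint, corner, NNReal.coe_natCast]

theorem abs_vectorCost_countVector_sub_le (ℓ : ℕ) (Y : Dataset) :
    |vectorCost C hC (countVector ℓ Y) - datasetCost C hC Y| ≤ 2 * (Y.card * (1 / 2) ^ ℓ) := by
  rw [vectorCost_countVector]
  unfold datasetCost
  induction Y using Multiset.induction_on with
  | empty => simp
  | cons a Y ih =>
    simp only [Multiset.map_cons, Multiset.sum_cons, Multiset.card_cons]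
    rw [add_sub_add_comm]
    have ha := (abs_distToCenters_sub_le C hC (corner ℓ (cell ℓ a.1)) a.1).trans
      ((l1Dist_comm _ _).le.trans (l1Dist_corner_cell_le ℓ a))
    refine (abs_add_le _ _).trans ((add_le_add ha ih).trans (le_of_eq ?_))
    push_cast
    ring

theorem datasetCost_nonneg (X : Dataset) : 0 ≤ datasetCost C hC X := by
  apply Multiset.sum_nonneg
  simp only [Multiset.mem_map]
  rintro _ ⟨x, _, rfl⟩
  exact distToCenters_nonneg C hC _

/-- Datasets that both fit the noisy counts up to a small error are coresets of each other. -/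
theorem isCoreset_countVector {k w r ℓ : ℕ} {lam N : ℝ} (hlam : 0 < lam) (hlam1 : lam < 1)
    (hr : 64 / lam ≤ r) (hw : 2 * (k * (2 * r + 1) ^ 2) ≤ w) (h : ℕ → ℕ × ℕ → ℤ) (X Y : Dataset)
    (hX : totalError w h ℓ X ≤ N) (hY : totalError w h ℓ Y ≤ 2 * N)
    (hcard : X.card * (1 / 2) ^ ℓ ≤ 2 * N) :
    IsCoreset k lam (100 * N) X (countVector ℓ Y) := by
  intro C hC hk
  have hr0 : (0 : ℝ) < r := lt_of_lt_of_le (by positivity) hr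
  have hr1 : 0 < r := by exact_mod_cast hr0
  rw [← hk] at hw
  have h1 := abs_datasetCost_sub_sum_roundedDist_le C hC w r hr1 hw h ℓ X
  have h2 := abs_datasetCost_sub_sum_roundedDist_le C hC w r hr1 hw h ℓ Y
  have h3 := abs_sum_roundedDist_sub_le C hC w h ℓ X Y
  have h4 := abs_vectorCost_countVector_sub_le C hC ℓ Y
  have hX0 := totalError_nonneg w h ℓ X
  have ha := datasetCost_nonneg C hC X
  have hb := datasetCost_nonneg C hC Y
  have hroot : ∀ Z, |(Z.card : ℝ) - h 0 (0, 0)| ≤ totalError w h ℓ Z := by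
    intro Z
    rw [totalError_eq_add_sum]
    exact le_add_of_nonneg_right (Finset.sum_nonneg fun _ _ =>
      mul_nonneg (by positivity) (levelError_nonneg _ _ _ _))
  have hp : (0 : ℝ) < (1 / 2) ^ ℓ := by positivity
  have hp1 : (1 / 2 : ℝ) ^ ℓ ≤ 1 := pow_le_one₀ (by norm_num) (by norm_num)
  -- The noisy root count is within `N` of `|X|` and `2N` of `|Y|`, so `|Y| ≤ |X| + 3N`.
  have hcardY : Y.card * (1 / 2 : ℝ) ^ ℓ ≤ 5 * N := by
    have h5 := abs_le.1 (hroot X)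
    have h6 := abs_le.1 (hroot Y)
    have h7 : (Y.card : ℝ) ≤ X.card + 3 * N := by linarith
    have := mul_le_mul_of_nonneg_right h7 hp.le
    nlinarith
  set a := datasetCost C hC X
  set b := datasetCost C hC Y
  set μ : ℝ := 16 / r with hμ
  have hμ0 : 0 < μ := by positivity
  have hμlam : μ ≤ lam / 4 := by
    rw [hμ, div_le_iff₀ hr0]
    rw [div_le_iff₀ hlam] at hr
    linarith
  -- The additive terms are `4N + 4N` for `X`, `8N + 10N` for `Y`, and `6N` between the rounded
  -- costs.
  have hab : |a - b| ≤ μ * (a + b) + 32 * N := by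
    rw [abs_le] at h1 h2 h3 ⊢
    constructor <;> linarith
  have hvb : |vectorCost C hC (countVector ℓ Y) - b| ≤ 10 * N := by linarith
  rw [abs_le] at hab hvb
  have hN : 0 ≤ N := hX0.trans hX
  have hlb : (1 - lam) * a - 32 * N ≤ b := by nlinarith
  -- Moving `μ * b` to the left is affordable because `μ ≤ lam / 4` gives `1 + μ ≤ (1 + lam) * (1 -
  -- μ)`.
  have hub : b ≤ (1 + lam) * a + 64 * N := by
    by_contra hc
    push Not at hc
    have h5 : b * (1 - μ) ≤ a * (1 + μ) + 32 * N := by nlinarith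
    have h6 : ((1 + lam) * a + 64 * N) * (1 - μ) < b * (1 - μ) :=
      mul_lt_mul_of_pos_right hc (by linarith)
    have h7 : 1 + μ ≤ (1 + lam) * (1 - μ) := by nlinarith
    have h8 := mul_le_mul_of_nonneg_left h7 ha
    nlinarith
  constructor <;> linarith

end Output

/-! ### Noise on a list of counts and sensitivity of a level -/

section NoisyCounts

/-- Independent two-sided geometric noise with rate `a` added to the listed counts. -/
noncomputable def noisyCounts (a : ℝ) (n : ℕ × ℕ → ℤ) : List (ℕ × ℕ) → PMF (ℕ × ℕ → ℤ)
  | [] => PMF.pure 0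
  | u :: l => (discreteLaplace a (n u)).bind fun v =>
      (noisyCounts a n l).bind fun y => PMF.pure (Function.update y u v)

theorem noisyCounts_expDominated {a : ℝ} (ha : 0 < a) (n n' : ℕ × ℕ → ℤ) (l : List (ℕ × ℕ)) :
    ExpDominated (a * (l.map fun u => |(n u : ℝ) - n' u|).sum)
      (noisyCounts a n l) (noisyCounts a n' l) := by
  induction l with
  | nil => simpa [noisyCounts] using ExpDominated.refl _
  | cons u l ih =>
    rw [List.map_cons, List.sum_cons, mul_add]
    exact (discreteLaplace_expDominated ha (n u) (n' u)).bind fun v => ih.bind_same _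

theorem pmfMean_noisyCounts_le {a : ℝ} (ha : 0 < a) (n : ℕ × ℕ → ℤ) (l : List (ℕ × ℕ))
    (hl : l.Nodup) :
    pmfMean (noisyCounts a n l)
      (fun y => (l.map fun u => ENNReal.ofReal |(n u : ℝ) - y u|).sum) ≤
      l.length * ENNReal.ofReal a⁻¹ := by
  induction l with
  | nil => simp [pmfMean]
  | cons u l ih =>
    have hl' := List.nodup_cons.1 hl
    unfold noisyCounts
    simp only [pmfMean_bind, pmfMean_pure, List.map_cons, List.sum_cons, Function.update_self]
    have h1 : ∀ (v : ℤ) (y : ℕ × ℕ → ℤ),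
        (l.map fun w => ENNReal.ofReal |(n w : ℝ) - (Function.update y u v w : ℤ)|) =
          l.map fun w => ENNReal.ofReal |(n w : ℝ) - y w| := by
      intro v y
      apply List.map_congr_left
      intro w hw
      -- Distinctness of the cells keeps the head's update from overwriting an entry of the tail.
      rw [Function.update_of_ne]
      rintro rfl
      exact hl'.1 hw
    simp_rw [h1, pmfMean_add, pmfMean_const]
    rw [List.length_cons, add_comm l.length 1, Nat.cast_add, Nat.cast_one, add_mul, one_mul]
    exact add_le_add (pmfMean_discreteLaplace_le ha (n u)) (ih hl'.2)

/-- A user's point lies in one cell per level, so a level costs its budget once, however many cells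
are queried. -/
theorem sum_abs_cellCount_sub_le (i : ℕ) {X X' : Dataset} (hX : Neighbors X X')
    (T : Finset (ℕ × ℕ)) :
    ∑ u ∈ T, |((cellCount i X u : ℤ) : ℝ) - ((cellCount i X' u : ℤ) : ℝ)| ≤ 1 := by
  have h : ∀ (a : UnitSquare) (Y : Dataset),
      ∑ u ∈ T, |((cellCount i (a ::ₘ Y) u : ℤ) : ℝ) - ((cellCount i Y u : ℤ) : ℝ)| ≤ 1 := by
    intro a Y
    calc _ = ∑ u ∈ T, if u = cell i a.1 then (1 : ℝ) else 0 := by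
          apply Finset.sum_congr rfl
          intro u _
          rw [cellCount_cons]
          split_ifs <;> simp
      _ ≤ 1 := by
          rw [Finset.sum_ite_eq']
          split_ifs <;> norm_num
  rcases hX with ⟨a, rfl⟩ | ⟨a, rfl⟩
  · simp_rw [abs_sub_comm (((cellCount i X _ : ℕ) : ℤ) : ℝ)]
    exact h a X
  · exact h a X'

end NoisyCounts

/-! ### The adaptive mechanism: privacy and expected error -/

section Mechanism

/-- Query the counts of the candidate cells of level `i` with privacy budget `e i`. -/
noncomputable def levelStep (e : ℕ → ℝ) (w : ℕ) (X : Dataset) (i : ℕ) (h : ℕ → ℕ × ℕ → ℤ) :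
    PMF (ℕ → ℕ × ℕ → ℤ) :=
  (noisyCounts (e i) (fun u => cellCount i X u) (queried w h i).toList).bind fun y =>
    PMF.pure (Function.update h i y)

/-- Query the levels `1, …, m` of the quadtree in turn. -/
noncomputable def levelSteps (e : ℕ → ℝ) (w : ℕ) (X : Dataset) (h : ℕ → ℕ × ℕ → ℤ) :
    ℕ → PMF (ℕ → ℕ × ℕ → ℤ)
  | 0 => PMF.pure h
  | m + 1 => (levelSteps e w X h m).bind (levelStep e w X (m + 1))

/-- The resolution used for a given noisy number of users. -/
noncomputable def resolution (ε : ℝ) (h : ℕ → ℕ × ℕ → ℤ) : ℕ := ⌈ε⌉₊ + (h 0 (0, 0)).natAbs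

/-- The noisy counts of all queried cells, up to the level given by the noisy number of users. -/
noncomputable def transcript (ε : ℝ) (e : ℕ → ℝ) (w : ℕ) (X : Dataset) :
    PMF (ℕ → ℕ × ℕ → ℤ) :=
  (levelStep e w X 0 0).bind fun h => levelSteps e w X h (resolution ε h)

theorem levelStep_expDominated {e : ℕ → ℝ} (he : ∀ i, 0 < e i) (w : ℕ) {X X' : Dataset}
    (hX : Neighbors X X') (i : ℕ) (h : ℕ → ℕ × ℕ → ℤ) :
    ExpDominated (e i) (levelStep e w X i h) (levelStep e w X' i h) := by
  refine ExpDominated.bind_same _ (ExpDominated.mono ?_ (noisyCounts_expDominated (he i) _ _ _))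
  rw [Finset.sum_map_toList]
  exact mul_le_of_le_one_right (he i).le (sum_abs_cellCount_sub_le i hX _)

theorem levelSteps_expDominated {e : ℕ → ℝ} (he : ∀ i, 0 < e i) (w : ℕ) {X X' : Dataset}
    (hX : Neighbors X X') (h : ℕ → ℕ × ℕ → ℤ) (m : ℕ) :
    ExpDominated (∑ i ∈ Finset.range m, e (i + 1)) (levelSteps e w X h m)
      (levelSteps e w X' h m) := by
  induction m with
  | zero => simpa [levelSteps] using ExpDominated.refl _
  | succ m ih =>
    rw [Finset.sum_range_succ]
    exact ih.bind fun h' => levelStep_expDominated he w hX (m + 1) h'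

/-- Given the root's noisy count, the depth is the same for both datasets, and the budgets sum to at
most `ε` at every depth; choosing the depth from the data is therefore free. -/
theorem transcript_expDominated {ε : ℝ} {e : ℕ → ℝ} (he : ∀ i, 0 < e i)
    (hsum : ∀ m, ∑ i ∈ Finset.range m, e i ≤ ε) (w : ℕ) {X X' : Dataset}
    (hX : Neighbors X X') : ExpDominated ε (transcript ε e w X) (transcript ε e w X') := by
  have h : ExpDominated (e 0 + (ε - e 0)) (transcript ε e w X) (transcript ε e w X') := by
    refine (levelStep_expDominated he w hX 0 0).bind fun h => ExpDominated.mono ?_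
      (levelSteps_expDominated he w hX h _)
    have := hsum (resolution ε h + 1)
    rw [Finset.sum_range_succ'] at this
    linarith
  simpa using h

theorem pmfMean_levelStep (e : ℕ → ℝ) (w : ℕ) (X : Dataset) (i : ℕ) (h : ℕ → ℕ × ℕ → ℤ)
    (g : (ℕ → ℕ × ℕ → ℤ) → ℝ≥0∞) :
    pmfMean (levelStep e w X i h) g =
      pmfMean (noisyCounts (e i) (fun u => cellCount i X u) (queried w h i).toList)
        fun y => g (Function.update h i y) := by
  unfold levelStep
  simp_rw [pmfMean_bind, pmfMean_pure]

theorem pmfMean_levelError_le {e : ℕ → ℝ} (he : ∀ i, 0 < e i) (X : Dataset) (i : ℕ)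
    (T : Finset (ℕ × ℕ)) :
    pmfMean (noisyCounts (e i) (fun u => cellCount i X u) T.toList)
      (fun y => ENNReal.ofReal (levelError i X T y)) ≤ T.card * ENNReal.ofReal (e i)⁻¹ := by
  have h := pmfMean_noisyCounts_le (he i) (fun u => cellCount i X u) T.toList T.nodup_toList
  rw [Finset.length_toList] at h
  refine le_trans (le_of_eq ?_) h
  congr 1
  ext y
  rw [Finset.sum_map_toList]
  unfold levelError
  rw [ENNReal.ofReal_sum_of_nonneg fun _ _ => abs_nonneg _]
  simp

theorem pmfMean_weighted_levelError_le {e b : ℕ → ℝ} {w : ℕ} (he : ∀ i, 0 < e i)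
    (hb : ∀ h i, (1 / 2) ^ i * ((queried w h i).card * (e i)⁻¹) ≤ b i) (X : Dataset) (i : ℕ)
    (h : ℕ → ℕ × ℕ → ℤ) :
    pmfMean (noisyCounts (e i) (fun u => cellCount i X u) (queried w h i).toList)
      (fun y => ENNReal.ofReal ((1 / 2) ^ i * levelError i X (queried w h i) y)) ≤
      ENNReal.ofReal (b i) := by
  have hp : (0 : ℝ) ≤ (1 / 2) ^ i := by positivity
  simp_rw [ENNReal.ofReal_mul hp]
  rw [pmfMean_const_mul]
  refine (mul_le_mul_right (pmfMean_levelError_le he X i _) _).trans ?_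
  rw [← ENNReal.ofReal_natCast, ← ENNReal.ofReal_mul (Nat.cast_nonneg _), ← ENNReal.ofReal_mul hp]
  exact ENNReal.ofReal_le_ofReal (hb h i)

theorem totalError_succ_update (w : ℕ) (h : ℕ → ℕ × ℕ → ℤ) (m : ℕ) (X : Dataset)
    (y : ℕ × ℕ → ℤ) :
    totalError w (Function.update h (m + 1) y) (m + 1) X = totalError w h m X +
      (1 / 2) ^ (m + 1) * levelError (m + 1) X (queried w h (m + 1)) y := by
  have h1 : ∀ j < m + 1, Function.update h (m + 1) y j = h j := fun j hj =>
    Function.update_of_ne hj.ne _ _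
  rw [← totalError_congr (h := Function.update h (m + 1) y) (fun j hj => h1 j (by omega)),
    ← queried_congr (h := Function.update h (m + 1) y) h1]
  unfold totalError
  rw [Finset.sum_range_succ, Function.update_self]

/-- The queried cells are random, but `b` bounds the next level's error uniformly over histories, so
the bounds add. -/
theorem pmfMean_levelSteps_totalError_le {e b : ℕ → ℝ} {w : ℕ} (he : ∀ i, 0 < e i)
    (hb : ∀ h i, (1 / 2) ^ i * ((queried w h i).card * (e i)⁻¹) ≤ b i) (hb0 : ∀ i, 0 ≤ b i)
    (X : Dataset) (h : ℕ → ℕ × ℕ → ℤ) (m : ℕ) :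
    pmfMean (levelSteps e w X h m) (fun h' => ENNReal.ofReal (totalError w h' m X)) ≤
      ENNReal.ofReal (totalError w h 0 X) +
        ENNReal.ofReal (∑ i ∈ Finset.range m, b (i + 1)) := by
  induction m with
  | zero => simp [levelSteps, pmfMean_pure]
  | succ m ih =>
    unfold levelSteps
    simp_rw [pmfMean_bind, pmfMean_levelStep, totalError_succ_update]
    calc _ ≤ pmfMean (levelSteps e w X h m) (fun h' =>
          ENNReal.ofReal (totalError w h' m X) + ENNReal.ofReal (b (m + 1))) := by
          apply pmfMean_mono
          intro h'
          simp_rw [ENNReal.ofReal_add (totalError_nonneg w h' m X)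
            (mul_nonneg (by positivity : (0 : ℝ) ≤ (1 / 2) ^ (m + 1)) (levelError_nonneg _ _ _ _)),
            pmfMean_add, pmfMean_const]
          exact add_le_add le_rfl (pmfMean_weighted_levelError_le he hb X (m + 1) h')
      _ ≤ _ := by
          rw [pmfMean_add, pmfMean_const, Finset.sum_range_succ,
            ENNReal.ofReal_add (Finset.sum_nonneg fun _ _ => hb0 _) (hb0 _), ← add_assoc]
          exact add_le_add ih le_rfl

/-- Ensures that the resolution read off the final transcript is the depth at which sampling
stopped. -/
theorem eq_zero_level_of_mem_support (e : ℕ → ℝ) (w : ℕ) (X : Dataset) (h : ℕ → ℕ × ℕ → ℤ)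
    (m : ℕ) : ∀ h' ∈ (levelSteps e w X h m).support, h' 0 = h 0 := by
  induction m with
  | zero =>
    intro h' hh
    unfold levelSteps at hh
    rw [PMF.mem_support_pure_iff] at hh
    rw [hh]
  | succ m ih =>
    intro h' hh
    unfold levelSteps levelStep at hh
    simp only [PMF.mem_support_bind_iff, PMF.mem_support_pure_iff] at hh
    obtain ⟨h'', h1, y, _, rfl⟩ := hh
    rw [Function.update_of_ne (by omega), ih _ h1]

theorem pmfMean_congr_support {α : Type*} (p : PMF α) {f g : α → ℝ≥0∞}
    (h : ∀ x ∈ p.support, f x = g x) : pmfMean p f = pmfMean p g := by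
  unfold pmfMean
  congr 1
  ext x
  by_cases hx : x ∈ p.support
  · rw [h x hx]
  · rw [(PMF.apply_eq_zero_iff p x).2 hx, zero_mul, zero_mul]

theorem pmfMean_transcript_totalError_le {ε B : ℝ} {e b : ℕ → ℝ} {w : ℕ} (he : ∀ i, 0 < e i)
    (hb : ∀ h i, (1 / 2) ^ i * ((queried w h i).card * (e i)⁻¹) ≤ b i) (hb0 : ∀ i, 0 ≤ b i)
    (hB : ∀ m, ∑ i ∈ Finset.range m, b i ≤ B) (X : Dataset) :
    pmfMean (transcript ε e w X)
      (fun h => ENNReal.ofReal (totalError w h (resolution ε h) X)) ≤ ENNReal.ofReal B := by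
  unfold transcript
  rw [pmfMean_bind]
  have hb00 : b 0 ≤ B := by simpa using hB 1
  calc _ ≤ pmfMean (levelStep e w X 0 0) (fun h =>
        ENNReal.ofReal (totalError w h 0 X) + ENNReal.ofReal (B - b 0)) := by
        apply pmfMean_mono
        intro h
        have h1 : ∀ h' ∈ (levelSteps e w X h (resolution ε h)).support,
            ENNReal.ofReal (totalError w h' (resolution ε h') X) =
              ENNReal.ofReal (totalError w h' (resolution ε h) X) := by
          intro h' hh
          unfold resolution
          rw [eq_zero_level_of_mem_support e w X h _ h' hh]
        rw [pmfMean_congr_support _ h1]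
        refine (pmfMean_levelSteps_totalError_le he hb hb0 X h _).trans (add_le_add le_rfl ?_)
        apply ENNReal.ofReal_le_ofReal
        have := hB (resolution ε h + 1)
        rw [Finset.sum_range_succ'] at this
        linarith
    _ ≤ ENNReal.ofReal (b 0) + ENNReal.ofReal (B - b 0) := by
        rw [pmfMean_add, pmfMean_const, pmfMean_levelStep]
        refine add_le_add (le_trans (le_of_eq ?_)
          (pmfMean_weighted_levelError_le he hb X 0 0)) le_rfl
        congr 1
        ext y
        simp [totalError, queried]
    _ = ENNReal.ofReal B := by
        rw [← ENNReal.ofReal_add (hb0 0) (by linarith)]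
        congr 1
        ring

/-- A dataset fitting the noisy counts `h` nearly as well as any other. -/
noncomputable def fittedDataset (δ : ℝ) (w : ℕ) (h : ℕ → ℕ × ℕ → ℤ) (ℓ : ℕ) : Dataset :=
  Classical.epsilon fun Y => ∀ Z, totalError w h ℓ Y ≤ totalError w h ℓ Z + δ

/-- The slack `δ` removes the need for the infimum to be attained. -/
theorem totalError_fittedDataset_le {δ : ℝ} (hδ : 0 < δ) (w : ℕ) (h : ℕ → ℕ × ℕ → ℤ) (ℓ : ℕ)
    (Z : Dataset) : totalError w h ℓ (fittedDataset δ w h ℓ) ≤ totalError w h ℓ Z + δ := by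
  have hbdd : BddBelow (Set.range fun Z => totalError w h ℓ Z) := by
    refine ⟨0, ?_⟩
    rintro _ ⟨Z, rfl⟩
    exact totalError_nonneg w h ℓ Z
  have hex : ∃ Y, ∀ Z, totalError w h ℓ Y ≤ totalError w h ℓ Z + δ := by
    obtain ⟨Y, hY⟩ := exists_lt_of_ciInf_lt
      (show ⨅ Z, totalError w h ℓ Z < (⨅ Z, totalError w h ℓ Z) + δ by linarith)
    exact ⟨Y, fun Z => hY.le.trans (add_le_add (ciInf_le hbdd Z) le_rfl)⟩
  exact Classical.epsilon_spec hex Z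

/-- The output computed from the noisy counts. -/
noncomputable def fittedVector (ε : ℝ) (w : ℕ) (h : ℕ → ℕ × ℕ → ℤ) : GridVector :=
  countVector (resolution ε h) (fittedDataset (1 / ε) w h (resolution ε h))

/-- Controls the cost of snapping to the final grid: `m * 2^-m ≤ 1` handles the noisy count, and the
extra `⌈ε⌉₊` levels reduce that 1 to `1 / ε`. -/
theorem card_mul_resolution_le {ε : ℝ} (hε : 0 < ε) (h : ℕ → ℕ × ℕ → ℤ) (n : ℕ) :
    n * (1 / 2 : ℝ) ^ resolution ε h ≤ 1 / ε + |(n : ℝ) - h 0 (0, 0)| := by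
  set m := (h 0 (0, 0)).natAbs with hm
  have hmc : (m : ℝ) = |((h 0 (0, 0) : ℤ) : ℝ)| := by
    rw [hm, Nat.cast_natAbs, Int.cast_abs]
  have h1 : (n : ℝ) ≤ m + |(n : ℝ) - h 0 (0, 0)| := by
    rw [hmc]
    linarith [le_abs_self ((n : ℝ) - h 0 (0, 0)), le_abs_self ((h 0 (0, 0) : ℤ) : ℝ)]
  have h2 : (m : ℝ) * (1 / 2) ^ m ≤ 1 := by
    rw [one_div, inv_pow, ← div_eq_mul_inv, div_le_one (by positivity)]
    exact_mod_cast Nat.lt_two_pow_self.le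
  have h3 : (1 / 2 : ℝ) ^ ⌈ε⌉₊ ≤ 1 / ε := by
    rw [one_div, inv_pow, one_div]
    apply inv_anti₀ hε
    refine (Nat.le_ceil ε).trans ?_
    exact_mod_cast Nat.lt_two_pow_self.le
  have h4 : (1 / 2 : ℝ) ^ resolution ε h = (1 / 2) ^ ⌈ε⌉₊ * (1 / 2) ^ m := by
    rw [← pow_add]
    rfl
  have h5 : (1 / 2 : ℝ) ^ resolution ε h ≤ 1 := pow_le_one₀ (by norm_num) (by norm_num)
  calc n * (1 / 2 : ℝ) ^ resolution ε h
      ≤ (m + |(n : ℝ) - h 0 (0, 0)|) * (1 / 2 : ℝ) ^ resolution ε h :=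
        mul_le_mul_of_nonneg_right h1 (by positivity)
    _ = (1 / 2) ^ ⌈ε⌉₊ * (m * (1 / 2 : ℝ) ^ m) +
        |(n : ℝ) - h 0 (0, 0)| * (1 / 2 : ℝ) ^ resolution ε h := by
        rw [h4]
        ring
    _ ≤ 1 / ε * 1 + |(n : ℝ) - h 0 (0, 0)| * 1 := by gcongr
    _ = _ := by ring

theorem isCoreset_fittedVector {ε lam N : ℝ} {k w r : ℕ} (hε : 0 < ε) (hlam : 0 < lam)
    (hlam1 : lam < 1) (hr : 64 / lam ≤ r) (hw : 2 * (k * (2 * r + 1) ^ 2) ≤ w)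
    (hN : 1 / ε ≤ N) (h : ℕ → ℕ × ℕ → ℤ) (X : Dataset)
    (hX : totalError w h (resolution ε h) X ≤ N) :
    IsCoreset k lam (100 * N) X (fittedVector ε w h) := by
  refine isCoreset_countVector hlam hlam1 hr hw h X _ hX ?_ ?_
  · have := totalError_fittedDataset_le (one_div_pos.2 hε) w h (resolution ε h) X
    linarith
  · have h1 := card_mul_resolution_le hε h X.card
    have h2 : |(X.card : ℝ) - h 0 (0, 0)| ≤ totalError w h (resolution ε h) X := by
      rw [totalError_eq_add_sum]
      exact le_add_of_nonneg_right (Finset.sum_nonneg fun _ _ =>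
        mul_nonneg (by positivity) (levelError_nonneg _ _ _ _))
    linarith

end Mechanism

/-! ### Distribution of the budget over the levels -/

section Budget

/-- With truncated subtraction the exponent is `|i - p|`; there is one geometric tail on each side
of `p`. -/
theorem sum_pow_dist_le {q : ℝ} (hq0 : 0 < q) (hq1 : q < 1) (p m : ℕ) :
    ∑ i ∈ Finset.range m, q ^ (i - p + (p - i)) ≤ 2 / (1 - q) := by
  have h1q : 0 < 1 - q := by linarith
  have h1 : ∀ m ≤ p, ∑ i ∈ Finset.range m, q ^ (i - p + (p - i)) ≤ q ^ (p - m + 1) / (1 - q) := by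
    intro m
    induction m with
    | zero =>
      intro _
      simp only [Finset.range_zero, Finset.sum_empty]
      positivity
    | succ m ih =>
      intro hm
      rw [Finset.sum_range_succ]
      refine (add_le_add (ih (by omega)) le_rfl).trans (le_of_eq ?_)
      have h2 : m - p + (p - m) = p - (m + 1) + 1 := by omega
      have h3 : p - m + 1 = p - (m + 1) + 1 + 1 := by omega
      rw [h2, h3, pow_succ _ (p - (m + 1) + 1)]
      field_simp
      ring
  have h2 : ∀ j, ∑ i ∈ Finset.range (p + j), q ^ (i - p + (p - i)) ≤
      (q + 1 - q ^ j) / (1 - q) := by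
    intro j
    induction j with
    | zero => simpa using h1 p le_rfl
    | succ j ih =>
      rw [← add_assoc, Finset.sum_range_succ]
      refine (add_le_add ih le_rfl).trans (le_of_eq ?_)
      have h3 : p + j - p + (p - (p + j)) = j := by omega
      rw [h3, pow_succ]
      field_simp
      ring
  calc _ ≤ ∑ i ∈ Finset.range (p + m), q ^ (i - p + (p - i)) := by
        apply Finset.sum_le_sum_of_subset_of_nonneg
        · exact Finset.range_mono (by omega)
        · intros
          positivity
    _ ≤ (q + 1 - q ^ m) / (1 - q) := h2 m
    _ ≤ 2 / (1 - q) := by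
        have := pow_pos hq0 m
        gcongr
        linarith

/-- The privacy budget of level `i`, decaying geometrically away from level `p`. -/
noncomputable def levelBudget (ε : ℝ) (p i : ℕ) : ℝ := ε / 8 * (3 / 4) ^ (i - p + (p - i))

theorem levelBudget_pos {ε : ℝ} (hε : 0 < ε) (p i : ℕ) : 0 < levelBudget ε p i := by
  unfold levelBudget
  positivity

theorem sum_levelBudget_le {ε : ℝ} (hε : 0 < ε) (p m : ℕ) :
    ∑ i ∈ Finset.range m, levelBudget ε p i ≤ ε := by
  unfold levelBudget
  rw [← Finset.mul_sum]
  -- The factor `ε / 8` in the budget cancels `2 / (1 - 3/4) = 8`.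
  have h := sum_pow_dist_le (q := 3 / 4) (by norm_num) (by norm_num) p m
  have h2 : ε / 8 * ∑ i ∈ Finset.range m, (3 / 4 : ℝ) ^ (i - p + (p - i)) ≤
      ε / 8 * (2 / (1 - 3 / 4)) := mul_le_mul_of_nonneg_left h (by positivity)
  linarith

/-- Up to level `p` the bound `4^i` is used, beyond it `4 * w`; the weighted number halves with each
level away from `p`. -/
theorem card_queried_weighted_le {w p : ℕ} (hw : 1 ≤ w) (hwp : w ≤ 4 ^ p) (h : ℕ → ℕ × ℕ → ℤ)
    (i : ℕ) : ((queried w h i).card : ℝ) * (1 / 2) ^ i ≤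
      4 * 2 ^ p * (1 / 2) ^ (i - p + (p - i)) := by
  have h4 : ∀ j : ℕ, (4 : ℝ) ^ j * (1 / 2) ^ j = 2 ^ j := by
    intro j
    rw [← mul_pow]
    norm_num
  have h2 : ∀ j : ℕ, (2 : ℝ) ^ j * (1 / 2) ^ j = 1 := by
    intro j
    rw [← mul_pow]
    norm_num
  rcases le_total i p with hip | hip
  · have h1 : ((queried w h i).card : ℝ) ≤ 4 ^ i := by
      exact_mod_cast card_queried_le_of_level w h i
    calc _ ≤ (4 : ℝ) ^ i * (1 / 2) ^ i := mul_le_mul_of_nonneg_right h1 (by positivity)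
      _ = 2 ^ i * (2 ^ (p - i) * (1 / 2) ^ (p - i)) := by rw [h4, h2, mul_one]
      _ = 2 ^ p * (1 / 2) ^ (p - i) := by
          rw [← mul_assoc, ← pow_add]
          congr 2
          omega
      _ ≤ 4 * (2 ^ p * (1 / 2) ^ (p - i)) :=
          le_mul_of_one_le_left (by positivity) (by norm_num)
      _ = _ := by
          rw [Nat.sub_eq_zero_of_le hip, zero_add]
          ring
  · have h1 : ((queried w h i).card : ℝ) ≤ 4 * 4 ^ p := by
      exact_mod_cast (card_queried_le_of_width hw h i).trans (Nat.mul_le_mul_left 4 hwp)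
    calc _ ≤ (4 * (4 : ℝ) ^ p) * (1 / 2) ^ i := mul_le_mul_of_nonneg_right h1 (by positivity)
      _ = 4 * (4 ^ p * (1 / 2) ^ p) * (1 / 2) ^ (i - p) := by
          conv_lhs => rw [← Nat.add_sub_cancel' hip, pow_add]
          ring
      _ = _ := by rw [h4, Nat.sub_eq_zero_of_le hip, add_zero]

/-- The budget ratio `3/4` lies strictly between `1/2` and 1, so the budgets are summable and so are
the errors, whose ratio is `(1/2) / (3/4) = 2/3`. -/
theorem weighted_card_div_levelBudget_le {ε : ℝ} (hε : 0 < ε) {w p : ℕ} (hw : 1 ≤ w)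
    (hwp : w ≤ 4 ^ p) (h : ℕ → ℕ × ℕ → ℤ) (i : ℕ) :
    (1 / 2) ^ i * ((queried w h i).card * (levelBudget ε p i)⁻¹) ≤
      32 * 2 ^ p / ε * (2 / 3) ^ (i - p + (p - i)) := by
  have h1 := card_queried_weighted_le hw hwp h i
  have h2 : (2 / 3 : ℝ) ^ (i - p + (p - i)) =
      (1 / 2) ^ (i - p + (p - i)) * ((3 / 4) ^ (i - p + (p - i)))⁻¹ := by
    rw [← inv_pow, ← mul_pow]
    norm_num
  rw [← mul_assoc, mul_comm ((1 / 2 : ℝ) ^ i)]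
  refine (mul_le_mul_of_nonneg_right h1 (inv_nonneg.2 (levelBudget_pos hε p i).le)).trans
    (le_of_eq ?_)
  rw [h2]
  unfold levelBudget
  rw [mul_inv, inv_div]
  ring

end Budget

/-! ### Choice of parameters and conclusion -/

section Parameters

/-- The radius, in cells, of the neighborhood of the centers used in the analysis. -/
noncomputable def nearRadius (lam : ℝ) : ℕ := ⌈64 / lam⌉₊

/-- The number of cells selected at each level. -/
noncomputable def selectionWidth (lam : ℝ) (k : ℕ) : ℕ := 2 * (k * (2 * nearRadius lam + 1) ^ 2)

/-- The level with the largest privacy budget. -/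
noncomputable def peakLevel (lam : ℝ) (k : ℕ) : ℕ := Nat.log 4 (selectionWidth lam k) + 1

/-- The private coreset mechanism as a discrete distribution. -/
noncomputable def coresetPMF (lam ε : ℝ) (k : ℕ) (X : Dataset) : PMF GridVector :=
  (transcript ε (levelBudget ε (peakLevel lam k)) (selectionWidth lam k) X).map
    (fittedVector ε (selectionWidth lam k))

/-- The private coreset mechanism. -/
noncomputable def coresetMechanism (lam ε : ℝ) (k : ℕ) (X : Dataset) :
    ProbabilityMeasure GridVector :=
  ⟨(coresetPMF lam ε k X).toMeasure, inferInstance⟩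

theorem coresetMechanism_isDP (lam : ℝ) {ε : ℝ} (hε : 0 < ε) (k : ℕ) :
    IsDP ε (coresetMechanism lam ε k) := by
  intro X X' hX O hO
  exact ((transcript_expDominated (levelBudget_pos hε _) (sum_levelBudget_le hε _) _ hX).bind_same
    _).toMeasure_le O hO

/-- This is where `√k` arises: `4^p` is at most `4w`, of order `k`, and `2^p` is its square root. -/
theorem two_pow_peakLevel_le (lam : ℝ) {k : ℕ} (hk : 1 ≤ k) :
    (2 : ℝ) ^ peakLevel lam k ≤ 4 * (2 * nearRadius lam + 1) * Real.sqrt k := by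
  have hw : selectionWidth lam k ≠ 0 := by
    unfold selectionWidth
    positivity
  have h1 : (4 : ℝ) ^ peakLevel lam k ≤ 4 * selectionWidth lam k := by
    unfold peakLevel
    rw [pow_succ, mul_comm]
    gcongr
    exact_mod_cast Nat.pow_log_le_self 4 hw
  refine (pow_le_pow_iff_left₀ (by positivity) (by positivity) two_ne_zero).1 ?_
  · rw [← pow_mul, mul_comm _ 2, pow_mul, mul_pow, Real.sq_sqrt (Nat.cast_nonneg _)]
    unfold selectionWidth at h1
    push_cast at h1
    have h2 : (0 : ℝ) ≤ k * (2 * nearRadius lam + 1) ^ 2 := by positivity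
    norm_num
    nlinarith

theorem coresetMechanism_isCoreset {lam ε : ℝ} (hlam : 0 < lam) (hlam1 : lam < 1) (hε : 0 < ε)
    {k : ℕ} (hk : 1 ≤ k) (X : Dataset) :
    ENNReal.ofReal (99 / 100) ≤ (coresetMechanism lam ε k X : Measure GridVector)
      {x | IsCoreset k lam (7680000 * (2 * nearRadius lam + 1) * Real.sqrt k / ε) X x} := by
  set w := selectionWidth lam k with hw
  set p := peakLevel lam k with hp
  -- The expected error is at most `192 * 2^p / ε`, and `192 * 4 = 768`; Markov's inequality at
  -- failure probability `1/100` gives the further factor 100.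
  set N : ℝ := 76800 * (2 * nearRadius lam + 1) * Real.sqrt k / ε with hN
  have hsqrt : 1 ≤ Real.sqrt k := Real.one_le_sqrt.2 (by exact_mod_cast hk)
  have hr0 : (0 : ℝ) ≤ nearRadius lam := Nat.cast_nonneg _
  have hNε : 1 / ε ≤ N := by
    rw [hN]
    apply div_le_div_of_nonneg_right _ hε.le
    nlinarith
  have hN0 : 0 < N := lt_of_lt_of_le (by positivity) hNε
  have hw1 : 1 ≤ w := by
    rw [Nat.one_le_iff_ne_zero, hw]
    unfold selectionWidth
    positivity
  have hwp : w ≤ 4 ^ p := (Nat.lt_pow_succ_log_self (by norm_num) w).le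
  have hmean := pmfMean_transcript_totalError_le (ε := ε) (B := N / 100)
    (levelBudget_pos hε p) (weighted_card_div_levelBudget_le hε hw1 hwp)
    (fun i => by positivity) (fun m => by
      rw [← Finset.mul_sum]
      have h1 := sum_pow_dist_le (q := 2 / 3) (by norm_num) (by norm_num) p m
      have h2 := two_pow_peakLevel_le lam hk
      calc _ ≤ 32 * 2 ^ p / ε * (2 / (1 - 2 / 3)) :=
            mul_le_mul_of_nonneg_left h1 (by positivity)
        _ = 192 * 2 ^ p / ε := by ring
        _ ≤ 192 * (4 * (2 * nearRadius lam + 1) * Real.sqrt k) / ε := by gcongr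
        _ = N / 100 := by
            rw [hN]
            ring) X
  -- The outer measure is a lower bound on every set, so measurability of the coreset event is not
  -- needed.
  refine le_trans ?_ (PMF.toOuterMeasure_apply_le_toMeasure_apply (coresetPMF lam ε k X) _)
  unfold coresetPMF
  have hκ : 7680000 * (2 * nearRadius lam + 1) * Real.sqrt k / ε = 100 * N := by
    rw [hN]
    ring
  rw [hκ]
  have hmark := le_toOuterMeasure_of_pmfMean_le (transcript ε (levelBudget ε p) w X)
    (fun h => totalError w h (resolution ε h) X)
    {h | IsCoreset k lam (100 * N) X (fittedVector ε w h)} N hN0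
    (fun h hh => isCoreset_fittedVector hε hlam hlam1 (Nat.le_ceil _) le_rfl hNε h X hh) hmean
  rw [PMF.toOuterMeasure_map_apply]
  exact hmark

end Parameters

end PrivateKMedian

theorem mainTheorem3 :
    ∃ (A : ℝ → ℝ)
      (M : (lam ε : ℝ) → (k : ℕ) → PrivateKMedian.Dataset →
        ProbabilityMeasure PrivateKMedian.GridVector),
      ∀ lam : ℝ, 0 < lam → lam < 1 →
        0 < A lam ∧
        ∀ ε : ℝ, 0 < ε → ∀ k : ℕ, 1 ≤ k →
          PrivateKMedian.IsDP ε (M lam ε k) ∧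
          ∀ X : PrivateKMedian.Dataset,
            ENNReal.ofReal (99 / 100) ≤
              (M lam ε k X : Measure PrivateKMedian.GridVector)
                {x | PrivateKMedian.IsCoreset k lam (A lam * Real.sqrt k / ε) X x} := by
  refine ⟨fun lam => 7680000 * (2 * PrivateKMedian.nearRadius lam + 1),
    PrivateKMedian.coresetMechanism, fun lam hlam hlam1 => ⟨by positivity, fun ε hε k hk =>
      ⟨PrivateKMedian.coresetMechanism_isDP lam hε k, fun X =>
        PrivateKMedian.coresetMechanism_isCoreset hlam hlam1 hε hk X⟩⟩⟩
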